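/- Let $G$ be a locally compact (Hausdorff) group with left Haar measure $\mu$ and modular function $\Delta$ (so that $\mu(Ex)=\Delta(x)\mu(E)$), and suppose that $G$ is of subexponential growth: for every compact set $K\subseteq G$ and every $t>0$ there is $C>0$ such that $\mu(K^n)\le Ce^{tn}$ for all $n\in\mathbb{N}$. Let $A$ be a (not necessarily unital) C*-algebra. Let $L^1(G,A)$ be the Banach $*$-algebra of Bochner integrable functions $G\to A$ whose product and involution are the continuous extensions of $$(f*g)(x)=\int_G f(t)\,g(t^{-1}x)\,d\mu(t),\qquad f^*(x)=\Delta(x^{-1})\,f(x^{-1})^*$$ from the dense $*$-subalgebra $C_c(G,A)$ of continuous functions of compact support. Then: (1) $C_c(G,A)$ is quasi-symmetric in $L^1(G,A)$, that is, $\mathrm{Sp}_{L^1(G,A)}(f^**f)\subseteq[0,\infty)$ for every $f\in C_c(G,A)$, where the spectrum is taken in the unitization if $L^1(G,A)$ has no unit. (2) $L^1(G,A)\cong L^1(G)\otimes_\gamma A$ canonically: there is an isometric $*$-isomorphism from the projective tensor product $L^1(G)\otimes_\gamma A$ (the completion of the algebraic tensor product in the norm $\gamma(z)=\inf\{\sum_i\|f_i\|\|a_i\|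 : z=\sum_i f_i\otimes a_i\}$, with product and involution determined by $(f\otimes a)(g\otimes b)=(f*g)\otimes ab$ and $(f\otimes a)^*=f^*\otimes a^*$) onto $L^1(G,A)$ that maps $f\otimes a$ to the function $x\mapsto f(x)a$. -/

import Mathlib

open MeasureTheory
open scoped TensorProduct Pointwise

set_option linter.unusedSectionVars false

noncomputable section

/-! ### Completing a normed star-algebra -/

namespace DenseExtension

variable {D E : Type*} [NonUnitalSeminormedRing D] [StarRing D] [NormedStarGroup D]
  [NormedSpace ℂ D] [IsScalarTower ℂ D D] [SMulCommClass ℂ D D] [StarModule ℂ D]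
  [NormedAddCommGroup E] [NormedSpace ℂ E] [CompleteSpace E]

/-- Left multiplication by an element of `D`, extended by continuity to `E`. -/
def mulLeft (ι : D →ₗᵢ[ℂ] E) (a : D) : E →L[ℂ] E :=
  (ι.toLinearMap ∘ₗ LinearMap.mulLeft ℂ a).extendOfNorm ι.toLinearMap

theorem mulLeft_bound (ι : D →ₗᵢ[ℂ] E) (a b : D) :
    ‖(ι.toLinearMap ∘ₗ LinearMap.mulLeft ℂ a) b‖ ≤ ‖a‖ * ‖ι.toLinearMap b‖ := by
  simpa using norm_mul_le a b

theorem mulLeft_apply (ι : D →ₗᵢ[ℂ] E) (hι : DenseRange ι) (a b : D) :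
    mulLeft ι a (ι b) = ι (a * b) :=
  LinearMap.extendOfNorm_eq (f := ι.toLinearMap ∘ₗ LinearMap.mulLeft ℂ a) (e := ι.toLinearMap) hι
    ⟨_, mulLeft_bound ι a⟩ b

theorem norm_mulLeft_apply_le (ι : D →ₗᵢ[ℂ] E) (hι : DenseRange ι) (a : D) (y : E) :
    ‖mulLeft ι a y‖ ≤ ‖a‖ * ‖y‖ :=
  LinearMap.norm_extendOfNorm_apply_le (e := ι.toLinearMap) hι _ (mulLeft_bound ι a) y

/-- `mulLeft`, as a linear map in the left factor. -/
def mulLeftₗ (ι : D →ₗᵢ[ℂ] E) (hι : DenseRange ι) : D →ₗ[ℂ] (E →L[ℂ] E) where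
  toFun := mulLeft ι
  map_add' a b := by
    refine ContinuousLinearMap.coeFn_injective (hι.equalizer (by fun_prop) (by fun_prop) ?_)
    funext d
    simp [mulLeft_apply ι hι, add_mul]
  map_smul' c a := by
    refine ContinuousLinearMap.coeFn_injective (hι.equalizer (by fun_prop) (by fun_prop) ?_)
    funext d
    simp [mulLeft_apply ι hι, smul_mul_assoc]

theorem mulLeftₗ_bound (ι : D →ₗᵢ[ℂ] E) (hι : DenseRange ι) (a : D) :
    ‖mulLeftₗ ι hι a‖ ≤ 1 * ‖ι.toLinearMap a‖ := by
  refine ContinuousLinearMap.opNorm_le_bound _ (by positivity) fun y => ?_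
  rw [one_mul]
  exact (norm_mulLeft_apply_le ι hι a y).trans_eq
    (by rw [LinearIsometry.coe_toLinearMap, ι.norm_map])

/-- The product of `D`, extended by continuity to a bilinear map on `E`. -/
def mulL (ι : D →ₗᵢ[ℂ] E) (hι : DenseRange ι) : E →L[ℂ] E →L[ℂ] E :=
  (mulLeftₗ ι hι).extendOfNorm ι.toLinearMap

theorem mulL_coe (ι : D →ₗᵢ[ℂ] E) (hι : DenseRange ι) (a : D) :
    mulL ι hι (ι a) = mulLeft ι a :=
  LinearMap.extendOfNorm_eq (e := ι.toLinearMap) hι ⟨_, mulLeftₗ_bound ι hι⟩ a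

theorem mulL_coe_coe (ι : D →ₗᵢ[ℂ] E) (hι : DenseRange ι) (a b : D) :
    mulL ι hι (ι a) (ι b) = ι (a * b) := by
  rw [mulL_coe, mulLeft_apply ι hι]

theorem norm_mulL_le (ι : D →ₗᵢ[ℂ] E) (hι : DenseRange ι) (x y : E) :
    ‖mulL ι hι x y‖ ≤ ‖x‖ * ‖y‖ := by
  refine ((mulL ι hι x).le_opNorm y).trans (mul_le_mul_of_nonneg_right ?_ (norm_nonneg y))
  exact (LinearMap.norm_extendOfNorm_apply_le (e := ι.toLinearMap) hι 1
    (mulLeftₗ_bound ι hι) x).trans_eq (one_mul _)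

theorem mulL_assoc (ι : D →ₗᵢ[ℂ] E) (hι : DenseRange ι) (x y z : E) :
    mulL ι hι (mulL ι hι x y) z = mulL ι hι x (mulL ι hι y z) := by
  induction x using hι.induction_on with
  | hp => exact isClosed_eq (by fun_prop) (by fun_prop)
  | ih a =>
    induction y using hι.induction_on with
    | hp => exact isClosed_eq (by fun_prop) (by fun_prop)
    | ih b =>
      induction z using hι.induction_on with
      | hp => exact isClosed_eq (by fun_prop) (by fun_prop)
      | ih c => simp only [mulL_coe_coe, mul_assoc]

/-- The involution of `D`, extended by continuity to `E`. -/
def starL (ι : D →ₗᵢ[ℂ] E) : E →L⋆[ℂ] E :=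
  (ι.toLinearMap ∘ₛₗ (starLinearEquiv ℂ : D ≃ₗ⋆[ℂ] D).toLinearMap).extendOfNorm ι.toLinearMap

theorem starL_bound (ι : D →ₗᵢ[ℂ] E) (a : D) :
    ‖(ι.toLinearMap ∘ₛₗ (starLinearEquiv ℂ : D ≃ₗ⋆[ℂ] D).toLinearMap) a‖ ≤
      1 * ‖ι.toLinearMap a‖ := by
  simp

theorem starL_coe (ι : D →ₗᵢ[ℂ] E) (hι : DenseRange ι) (a : D) :
    starL ι (ι a) = ι (star a) :=
  LinearMap.extendOfNorm_eq (e := ι.toLinearMap) hι ⟨_, starL_bound ι⟩ a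

theorem norm_starL_le (ι : D →ₗᵢ[ℂ] E) (hι : DenseRange ι) (x : E) : ‖starL ι x‖ ≤ ‖x‖ := by
  exact (LinearMap.norm_extendOfNorm_apply_le (e := ι.toLinearMap) hι 1
    (starL_bound ι) x).trans_eq (one_mul _)

/-- `E` as a Banach algebra, for the product extended from `D`. -/
@[reducible] def nonUnitalNormedRing (ι : D →ₗᵢ[ℂ] E) (hι : DenseRange ι) :
    NonUnitalNormedRing E :=
  { (inferInstance : NormedAddCommGroup E) with
    mul := fun x y => mulL ι hι x y
    left_distrib := fun x y z => (mulL ι hι x).map_add y z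
    right_distrib := fun x y z => by
      change mulL ι hι (x + y) z = mulL ι hι x z + mulL ι hι y z
      simp
    zero_mul := fun x => by
      change mulL ι hι 0 x = 0
      simp
    mul_zero := fun x => (mulL ι hι x).map_zero
    mul_assoc := fun x y z => mulL_assoc ι hι x y z
    norm_mul_le := fun x y => norm_mulL_le ι hι x y }

/-- The involution of the Banach algebra `E`, extended from `D`. -/
@[reducible] def starRing (ι : D →ₗᵢ[ℂ] E) (hι : DenseRange ι) :
    letI := nonUnitalNormedRing ι hι
    StarRing E :=
  letI := nonUnitalNormedRing ι hι
  { star := starL ι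
    star_involutive := fun x => by
      induction x using hι.induction_on with
      | hp => exact isClosed_eq (by fun_prop) (by fun_prop)
      | ih a => simp only [starL_coe ι hι, star_star]
    star_add := fun x y => (starL ι).map_add x y
    star_mul := fun x y => by
      change starL ι (mulL ι hι x y) = mulL ι hι (starL ι y) (starL ι x)
      induction x using hι.induction_on with
      | hp => exact isClosed_eq (by fun_prop) (by fun_prop)
      | ih a =>
        induction y using hι.induction_on with
        | hp => exact isClosed_eq (by fun_prop) (by fun_prop)
        | ih b => simp only [starL_coe ι hι, mulL_coe_coe ι hι, star_mul] }

theorem isScalarTower (ι : D →ₗᵢ[ℂ] E) (hι : DenseRange ι) :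
    letI := nonUnitalNormedRing ι hι
    IsScalarTower ℂ E E :=
  letI := nonUnitalNormedRing ι hι
  ⟨fun c x y => by
    change mulL ι hι (c • x) y = c • mulL ι hι x y
    simp⟩

theorem smulCommClass (ι : D →ₗᵢ[ℂ] E) (hι : DenseRange ι) :
    letI := nonUnitalNormedRing ι hι
    SMulCommClass ℂ E E :=
  letI := nonUnitalNormedRing ι hι
  ⟨fun c x y => ((mulL ι hι x).map_smul c y).symm⟩

theorem starModule (ι : D →ₗᵢ[ℂ] E) (hι : DenseRange ι) :
    letI := nonUnitalNormedRing ι hι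
    letI := starRing ι hι
    StarModule ℂ E :=
  letI := nonUnitalNormedRing ι hι
  letI := starRing ι hι
  ⟨fun c x => (starL ι).map_smulₛₗ c x⟩

theorem normedStarGroup (ι : D →ₗᵢ[ℂ] E) (hι : DenseRange ι) :
    letI := nonUnitalNormedRing ι hι
    letI := starRing ι hι
    NormedStarGroup E :=
  letI := nonUnitalNormedRing ι hι
  letI := starRing ι hι
  ⟨fun x => norm_starL_le ι hι x⟩

end DenseExtension

/-! ### Compactly supported continuous functions on a group under convolution -/

namespace GroupL1

open CompactlySupportedContinuousMap CompactlySupported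

section Modular

variable {G : Type*} [Group G] [TopologicalSpace G] [IsTopologicalGroup G]
  [LocallyCompactSpace G] [MeasurableSpace G] [BorelSpace G]

theorem integral_mul_right_eq (μ : Measure G) [μ.IsHaarMeasure] {f : G → ℝ} (hf : Continuous f)
    (hfc : HasCompactSupport f) (g : G) :
    ∫ x, f (x * g) ∂μ = (Measure.modularCharacterFun g : ℝ) * ∫ x, f x ∂μ := by
  have h := Measure.integral_isMulLeftInvariant_eq_smul_of_hasCompactSupport
    (μ.map (· * g)) μ hf hfc
  rw [← Measure.modularCharacterFun_eq_haarScalarFactor μ g, integral_smul_nnreal_measure] at h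
  rw [← integral_map (φ := (· * g)) (by fun_prop) hf.aestronglyMeasurable, h]
  rfl

theorem continuous_modularCharacterFun :
    Continuous fun g : G => (Measure.modularCharacterFun g : ℝ) := by
  let μ : Measure G := Measure.haar
  obtain ⟨⟨f, hf⟩, hfc, hf0, hf1⟩ :
    ∃ f : C(G, ℝ), HasCompactSupport f ∧ 0 ≤ f ∧ f 1 ≠ 0 := exists_continuous_nonneg_pos 1
  have hpos : ∫ x, f x ∂μ ≠ 0 :=
    (hf.integral_pos_of_hasCompactSupport_nonneg_nonzero hfc hf0 hf1).ne'
  have h : (fun g : G => (Measure.modularCharacterFun g : ℝ)) =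
      fun g => (∫ y, f (y⁻¹ * g) ∂μ.inv) / ∫ x, f x ∂μ := by
    funext g
    rw [eq_div_iff hpos, ← integral_mul_right_eq μ hf hfc, Measure.inv,
      integral_map (by fun_prop) (Continuous.aestronglyMeasurable (by fun_prop))]
    simp
  rw [h]
  exact (continuous_integral_apply_inv_mul hf hfc).div_const _

theorem integral_modular_inv (μ : Measure G) [μ.IsHaarMeasure] {f : G → ℝ} (hf : Continuous f)
    (hfc : HasCompactSupport f) :
    ∫ x, (Measure.modularCharacterFun x : ℝ) * f x⁻¹ ∂μ = ∫ x, f x ∂μ := by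
  obtain ⟨⟨g, hg⟩, hgc, hg0, hg1⟩ :
    ∃ g : C(G, ℝ), HasCompactSupport g ∧ 0 ≤ g ∧ g 1 ≠ 0 := exists_continuous_nonneg_pos 1
  have hpos : ∫ x, g x ∂μ ≠ 0 :=
    (hg.integral_pos_of_hasCompactSupport_nonneg_nonzero hgc hg0 hg1).ne'
  have h := Measure.integral_isMulLeftInvariant_isMulRightInvariant_combo (μ := μ) (ν := μ.inv)
    hf hfc hg hgc hg0 hg1
  have hD : ∀ y, ∫ z, g (z⁻¹ * y) ∂μ.inv = (Measure.modularCharacterFun y : ℝ) * ∫ x, g x ∂μ := by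
    intro y
    rw [← integral_mul_right_eq μ hg hgc, Measure.inv,
      integral_map (by fun_prop) (Continuous.aestronglyMeasurable (by fun_prop))]
    simp
  have hinv : ∀ x : G, (Measure.modularCharacterFun x⁻¹ : ℝ) =
      (Measure.modularCharacterFun x : ℝ)⁻¹ := by
    intro x
    have := map_inv (Measure.modularCharacter (G := G)) x
    exact_mod_cast congrArg NNReal.toReal this
  have hcont : Continuous fun y => f y * ((Measure.modularCharacterFun y : ℝ) *
      ∫ x, g x ∂μ)⁻¹ := by
    refine hf.mul (Continuous.inv₀ (continuous_modularCharacterFun.mul continuous_const) ?_)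
    intro y
    have := Measure.modularCharacterFun_pos y
    exact mul_ne_zero (by exact_mod_cast this.ne') hpos
  simp only [hD] at h
  rw [h, Measure.inv, integral_map (by fun_prop) hcont.aestronglyMeasurable, ← integral_mul_const]
  congr 1
  funext x
  rw [hinv x]
  field_simp

end Modular

section Convolution

variable {G : Type*} [Group G] [TopologicalSpace G] [IsTopologicalGroup G]
  [LocallyCompactSpace G] [T2Space G] [MeasurableSpace G] [BorelSpace G]
  {A : Type*} [NonUnitalCStarAlgebra A]

/-- The convolution `(f * g)(x) = ∫ f(t) g(t⁻¹ x) dt`. -/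
def conv (μ : Measure G) (f g : G → A) (x : G) : A := ∫ t, f t * g (t⁻¹ * x) ∂μ

/-- The involution `f^*(x) = Δ(x⁻¹) f(x⁻¹)^*`. Here `Δ` is the modular function with
`μ (E x) = Δ(x) μ(E)`; Mathlib's `modularCharacterFun x` is defined by
`μ (E x⁻¹) = modularCharacterFun x * μ E`, so that it is `Δ(x⁻¹)`. -/
def involution (f : G → A) (x : G) : A :=
  (Measure.modularCharacterFun x : ℝ) • star (f x⁻¹)

theorem hasCompactSupport_kernel {E : Type*} [Zero E] {F : G × G → E} {K L : Set G}
    (hK : IsCompact K) (hL : IsCompact L) (h : ∀ x y, F (x, y) ≠ 0 → x ∈ K ∧ y ∈ L) :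
    HasCompactSupport F :=
  HasCompactSupport.intro (hK.prod hL) fun p hp => by
    by_contra hne
    exact hp (h p.1 p.2 hne)

theorem mem_of_mul_ne_zero {f g : G → A} {t x : G} (h : f t * g (t⁻¹ * x) ≠ 0) :
    t ∈ tsupport f ∧ t⁻¹ * x ∈ tsupport g ∧ x ∈ tsupport f * tsupport g := by
  have h1 : t ∈ tsupport f := subset_tsupport _ (left_ne_zero_of_mul h)
  have h2 : t⁻¹ * x ∈ tsupport g := subset_tsupport _ (right_ne_zero_of_mul h)
  exact ⟨h1, h2, ⟨t, h1, t⁻¹ * x, h2, by simp⟩⟩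

theorem continuous_conv (μ : Measure G) [μ.IsHaarMeasure] {f g : G → A} (hf : Continuous f)
    (hfc : HasCompactSupport f) (hg : Continuous g) : Continuous (conv μ f g) := by
  rw [← continuousOn_univ]
  refine continuousOn_integral_of_compact_support (f := fun x t => f t * g (t⁻¹ * x)) hfc
    (Continuous.continuousOn (by fun_prop)) fun p x _ hx => ?_
  rw [image_eq_zero_of_notMem_tsupport hx, zero_mul]

theorem hasCompactSupport_conv (μ : Measure G) {f g : G → A}
    (hfc : HasCompactSupport f) (hgc : HasCompactSupport g) : HasCompactSupport (conv μ f g) := by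
  refine HasCompactSupport.intro (hfc.isCompact.mul hgc.isCompact) fun x hx => ?_
  have : ∀ t, f t * g (t⁻¹ * x) = 0 := fun t => by
    by_contra hne
    exact hx (mem_of_mul_ne_zero hne).2.2
  simp [conv, this]

theorem integrable_conv_kernel (μ : Measure G) [μ.IsHaarMeasure] {f g : G → A} (hf : Continuous f)
    (hfc : HasCompactSupport f) (hg : Continuous g) (x : G) :
    Integrable (fun t => f t * g (t⁻¹ * x)) μ :=
  Continuous.integrable_of_hasCompactSupport (by fun_prop) hfc.mul_right

theorem integral_mul_const' (μ : Measure G) {f : G → A} (hf : Integrable f μ) (c : A) :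
    (∫ t, f t ∂μ) * c = ∫ t, f t * c ∂μ :=
  (((ContinuousLinearMap.mul ℂ A).flip c).integral_comp_comm hf).symm

theorem integral_const_mul' (μ : Measure G) {f : G → A} (hf : Integrable f μ) (c : A) :
    c * (∫ t, f t ∂μ) = ∫ t, c * f t ∂μ :=
  ((ContinuousLinearMap.mul ℂ A c).integral_comp_comm hf).symm

theorem conv_assoc (μ : Measure G) [μ.IsHaarMeasure] {f g h : G → A}
    (hf : Continuous f) (hfc : HasCompactSupport f) (hg : Continuous g)
    (hgc : HasCompactSupport g) (hh : Continuous h) (x : G) :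
    conv μ (conv μ f g) h x = conv μ f (conv μ g h) x := by
  have h1 : conv μ (conv μ f g) h x =
      ∫ t, ∫ s, f s * g (s⁻¹ * t) * h (t⁻¹ * x) ∂μ ∂μ := by
    refine integral_congr_ae (ae_of_all _ fun t => ?_)
    exact integral_mul_const' μ (integrable_conv_kernel μ hf hfc hg t) _
  have h2 : conv μ f (conv μ g h) x =
      ∫ s, ∫ t, f s * g (s⁻¹ * t) * h (t⁻¹ * x) ∂μ ∂μ := by
    refine integral_congr_ae (ae_of_all _ fun s => ?_)
    change f s * conv μ g h (s⁻¹ * x) = _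
    rw [conv, integral_const_mul' μ (integrable_conv_kernel μ hg hgc hh _),
      ← integral_mul_left_eq_self _ s⁻¹]
    refine integral_congr_ae (ae_of_all _ fun t => ?_)
    simp [mul_assoc]
  rw [h1, h2]
  refine integral_integral_swap_of_hasCompactSupport
    (f := fun t s => f s * g (s⁻¹ * t) * h (t⁻¹ * x)) (by fun_prop) ?_
  refine hasCompactSupport_kernel (hfc.isCompact.mul hgc.isCompact) hfc.isCompact
    fun t s hne => ?_
  have := mem_of_mul_ne_zero (left_ne_zero_of_mul hne)
  exact ⟨this.2.2, this.1⟩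

theorem continuous_involution {f : G → A} (hf : Continuous f) : Continuous (involution f) := by
  unfold involution
  have := continuous_modularCharacterFun (G := G)
  fun_prop

theorem hasCompactSupport_involution {f : G → A} (hfc : HasCompactSupport f) :
    HasCompactSupport (involution f) := by
  refine HasCompactSupport.intro hfc.isCompact.inv fun x hx => ?_
  have : f x⁻¹ = 0 := image_eq_zero_of_notMem_tsupport (by simpa using hx)
  simp [involution, this]

theorem modular_inv (x : G) : (Measure.modularCharacterFun x⁻¹ : ℝ) =
    (Measure.modularCharacterFun x : ℝ)⁻¹ := by
  have := map_inv (Measure.modularCharacter (G := G)) x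
  exact_mod_cast congrArg NNReal.toReal this

theorem modular_ne_zero (x : G) : (Measure.modularCharacterFun x : ℝ) ≠ 0 := by
  have := Measure.modularCharacterFun_pos x
  exact_mod_cast this.ne'

theorem involution_involution (f : G → A) (x : G) : involution (involution f) x = f x := by
  simp [involution, smul_smul, modular_inv, mul_inv_cancel₀ (modular_ne_zero x)]

theorem involution_conv (μ : Measure G) [μ.IsHaarMeasure] (f g : G → A) (x : G) :
    involution (conv μ f g) x = conv μ (involution g) (involution f) x := by
  have h1 : star (conv μ f g x⁻¹) = ∫ t, star (g (t⁻¹ * x⁻¹)) * star (f t) ∂μ := by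
    have := ((starL' ℝ : A ≃L[ℝ] A).integral_comp_comm (μ := μ)
      (fun t => f t * g (t⁻¹ * x⁻¹))).symm
    simpa [conv] using this
  rw [involution, h1, conv, ← integral_smul, ← integral_mul_left_eq_self _ x⁻¹]
  refine integral_congr_ae (ae_of_all _ fun t => ?_)
  have hm : (Measure.modularCharacterFun x : ℝ) =
      Measure.modularCharacterFun t * Measure.modularCharacterFun (t⁻¹ * x) := by
    rw [← NNReal.coe_mul, ← Measure.modularCharacterFun_map_mul, mul_inv_cancel_left]
  simp [involution, smul_mul_smul_comm, ← hm]

theorem integral_norm_involution (μ : Measure G) [μ.IsHaarMeasure] {f : G → A}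
    (hf : Continuous f) (hfc : HasCompactSupport f) :
    ∫ x, ‖involution f x‖ ∂μ = ∫ x, ‖f x‖ ∂μ := by
  rw [← integral_modular_inv μ hf.norm hfc.norm]
  simp [involution, norm_smul]

theorem integral_norm_conv_le (μ : Measure G) [μ.IsHaarMeasure] {f g : G → A}
    (hf : Continuous f) (hfc : HasCompactSupport f) (hg : Continuous g)
    (hgc : HasCompactSupport g) :
    ∫ x, ‖conv μ f g x‖ ∂μ ≤ (∫ x, ‖f x‖ ∂μ) * ∫ x, ‖g x‖ ∂μ := by
  have hF : Continuous (Function.uncurry fun x t => ‖f t‖ * ‖g (t⁻¹ * x)‖) := by fun_prop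
  have hFc : HasCompactSupport (Function.uncurry fun x t => ‖f t‖ * ‖g (t⁻¹ * x)‖) := by
    refine hasCompactSupport_kernel (hfc.isCompact.mul hgc.isCompact) hfc.isCompact
      fun x t hne => ?_
    have h1 : t ∈ tsupport f :=
      subset_tsupport _ (norm_ne_zero_iff.1 (left_ne_zero_of_mul hne))
    have h2 : t⁻¹ * x ∈ tsupport g :=
      subset_tsupport _ (norm_ne_zero_iff.1 (right_ne_zero_of_mul hne))
    exact ⟨⟨t, h1, t⁻¹ * x, h2, by simp⟩, h1⟩
  have hint : Integrable (fun x => ∫ t, ‖f t‖ * ‖g (t⁻¹ * x)‖ ∂μ) μ := by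
    refine Continuous.integrable_of_hasCompactSupport ?_ ?_
    · rw [← continuousOn_univ]
      refine continuousOn_integral_of_compact_support hfc hF.continuousOn fun p t _ ht => ?_
      rw [image_eq_zero_of_notMem_tsupport ht, norm_zero, zero_mul]
    · refine HasCompactSupport.intro (hfc.isCompact.mul hgc.isCompact) fun x hx => ?_
      refine integral_eq_zero_of_ae (ae_of_all _ fun t => ?_)
      by_contra hne
      have h1 : t ∈ tsupport f :=
        subset_tsupport _ (norm_ne_zero_iff.1 (left_ne_zero_of_mul hne))
      have h2 : t⁻¹ * x ∈ tsupport g :=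
        subset_tsupport _ (norm_ne_zero_iff.1 (right_ne_zero_of_mul hne))
      exact hx ⟨t, h1, t⁻¹ * x, h2, by simp⟩
  calc ∫ x, ‖conv μ f g x‖ ∂μ ≤ ∫ x, ∫ t, ‖f t‖ * ‖g (t⁻¹ * x)‖ ∂μ ∂μ := by
        refine integral_mono_of_nonneg (ae_of_all _ fun x => norm_nonneg _) hint
          (ae_of_all _ fun x => ?_)
        refine norm_integral_le_of_norm_le ?_ (ae_of_all _ fun t => norm_mul_le _ _)
        exact Continuous.integrable_of_hasCompactSupport (by fun_prop) hfc.norm.mul_right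
    _ = ∫ t, ∫ x, ‖f t‖ * ‖g (t⁻¹ * x)‖ ∂μ ∂μ :=
        integral_integral_swap_of_hasCompactSupport hF hFc
    _ = ∫ t, ‖f t‖ * ∫ x, ‖g x‖ ∂μ ∂μ := by
        refine integral_congr_ae (ae_of_all _ fun t => ?_)
        change ∫ x, ‖f t‖ * ‖g (t⁻¹ * x)‖ ∂μ = _
        rw [integral_const_mul, integral_mul_left_eq_self (fun x => ‖g x‖) t⁻¹]
    _ = (∫ x, ‖f x‖ ∂μ) * ∫ x, ‖g x‖ ∂μ := integral_mul_const _ _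

end Convolution

section Density

/-- Continuous functions of compact support are dense in `L¹` of a locally compact Hausdorff space
(which need not be normal). -/
theorem exists_cc_eLpNorm_sub_le {X : Type*} [TopologicalSpace X] [LocallyCompactSpace X]
    [T2Space X] [MeasurableSpace X] [BorelSpace X] {μ : Measure X} [μ.Regular]
    {E : Type*} [NormedAddCommGroup E] [NormedSpace ℝ E] {f : X → E} (hf : MemLp f 1 μ)
    {ε : ENNReal} (hε : ε ≠ 0) :
    ∃ g : X → E, eLpNorm (f - g) 1 μ ≤ ε ∧ Continuous g ∧ MemLp g 1 μ ∧ HasCompactSupport g := by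
  refine hf.induction_dense ENNReal.one_ne_top _ ?_ ?_ ?_ hε
  · intro c t ht htμ ε hε
    obtain ⟨η, ηpos, hη⟩ := exists_eLpNorm_indicator_le (μ := μ) (p := 1) ENNReal.one_ne_top c hε
    have hη2 : (η : ENNReal) / 2 ≠ 0 := by simpa using ηpos.ne'
    obtain ⟨s, st, s_compact, s_closed, μs⟩ := ht.exists_isCompact_isClosed_sdiff_lt htμ.ne hη2
    have hsμ : μ s < ⊤ := (measure_mono st).trans_lt htμ
    obtain ⟨V, sV, V_open, -, hV⟩ := s_closed.measurableSet.exists_isOpen_sdiff_lt hsμ.ne hη2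
    obtain ⟨g, hg1, hg0, hgc, hgI⟩ := exists_continuous_one_zero_of_isCompact s_compact
      V_open.isClosed_compl (Set.disjoint_compl_right_iff_subset.2 sV)
    refine ⟨fun x => g x • c, ?_, by fun_prop,
      Continuous.memLp_of_hasCompactSupport (by fun_prop) hgc.smul_right, hgc.smul_right⟩
    have hle : μ ((V \ s) ∪ (t \ s)) ≤ η := by
      refine (measure_union_le _ _).trans ((add_le_add hV.le μs.le).trans_eq ?_)
      exact ENNReal.add_halves _
    refine (eLpNorm_mono fun x => ?_).trans (hη _ hle)
    have hb : ‖g x • c‖ ≤ ‖c‖ := by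
      rw [norm_smul, Real.norm_of_nonneg (hgI x).1]
      exact mul_le_of_le_one_left (norm_nonneg _) (hgI x).2
    have hb' : ‖g x • c - c‖ ≤ ‖c‖ := by
      rw [← norm_neg, neg_sub]
      nth_rewrite 1 [← one_smul ℝ c]
      rw [← sub_smul, norm_smul, Real.norm_of_nonneg (sub_nonneg.2 (hgI x).2)]
      exact mul_le_of_le_one_left (norm_nonneg _) (sub_le_self _ (hgI x).1)
    by_cases hxs : x ∈ s
    · have h1 : g x = 1 := hg1 hxs
      simp [h1, st hxs]
    · by_cases hxt : x ∈ t
      · simpa [hxs, hxt] using hb'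
      · by_cases hxV : x ∈ V
        · simpa [hxs, hxt, hxV] using hb
        · have h0 : g x = 0 := hg0 hxV
          simp [h0, hxt]
  · rintro f g ⟨f_cont, f_mem, hf⟩ ⟨g_cont, g_mem, hg⟩
    exact ⟨f_cont.add g_cont, f_mem.add g_mem, hf.add hg⟩
  · rintro f ⟨_, f_mem, _⟩
    exact f_mem.aestronglyMeasurable

end Density

section Algebra

/-- The space `C_c(G, A)` of continuous functions of compact support, to be equipped with the
convolution and involution given by the Haar measure `μ`. -/
def Cc {G : Type*} [TopologicalSpace G] [MeasurableSpace G] (_μ : Measure G)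
    (A : Type*) [NonUnitalCStarAlgebra A] : Type _ := C_c(G, A)

/-- The Banach space `L¹(G, A)` of (classes of) Bochner integrable functions, to be equipped with
the convolution and involution given by the Haar measure `μ`. -/
def L1 {G : Type*} [MeasurableSpace G] (μ : Measure G)
    (A : Type*) [NonUnitalCStarAlgebra A] : Type _ := Lp A 1 μ

variable {G : Type*} [Group G] [TopologicalSpace G] [IsTopologicalGroup G]
  [LocallyCompactSpace G] [T2Space G] [MeasurableSpace G] [BorelSpace G]
  (μ : Measure G) (A : Type*) [NonUnitalCStarAlgebra A]

instance : AddCommGroup (Cc μ A) := inferInstanceAs (AddCommGroup C_c(G, A))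
instance : Module ℂ (Cc μ A) := inferInstanceAs (Module ℂ C_c(G, A))
instance : FunLike (Cc μ A) G A := inferInstanceAs (FunLike C_c(G, A) G A)

instance : NormedAddCommGroup (L1 μ A) := inferInstanceAs (NormedAddCommGroup (Lp A 1 μ))
instance : NormedSpace ℂ (L1 μ A) := inferInstanceAs (NormedSpace ℂ (Lp A 1 μ))
instance : CompleteSpace (L1 μ A) := inferInstanceAs (CompleteSpace (Lp A 1 μ))

variable {μ A}

namespace Cc

theorem continuous (f : Cc μ A) : Continuous f := f.toContinuousMap.continuous
theorem hasCompactSupport (f : Cc μ A) : HasCompactSupport f := f.hasCompactSupport'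

@[ext] theorem ext {f g : Cc μ A} (h : ∀ x, f x = g x) : f = g :=
  CompactlySupportedContinuousMap.ext h

@[simp] theorem add_apply (f g : Cc μ A) (x : G) : (f + g) x = f x + g x := rfl
@[simp] theorem neg_apply (f : Cc μ A) (x : G) : (-f) x = -f x := rfl
@[simp] theorem zero_apply (x : G) : (0 : Cc μ A) x = 0 := rfl
@[simp] theorem smul_apply (c : ℂ) (f : Cc μ A) (x : G) : (c • f) x = c • f x := rfl

variable [μ.IsHaarMeasure]

theorem integrable (f : Cc μ A) : Integrable f μ :=
  f.continuous.integrable_of_hasCompactSupport f.hasCompactSupport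

theorem memLp (f : Cc μ A) : MemLp f 1 μ := memLp_one_iff_integrable.2 f.integrable

instance : Mul (Cc μ A) where
  mul f g := ⟨⟨conv μ f g, continuous_conv μ f.continuous f.hasCompactSupport g.continuous⟩,
    hasCompactSupport_conv μ f.hasCompactSupport g.hasCompactSupport⟩

instance : Star (Cc μ A) where
  star f := ⟨⟨involution f, continuous_involution f.continuous⟩,
    hasCompactSupport_involution f.hasCompactSupport⟩

theorem mul_apply (f g : Cc μ A) (x : G) : (f * g) x = ∫ t, f t * g (t⁻¹ * x) ∂μ := rfl

theorem star_apply (f : Cc μ A) (x : G) :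
    (star f) x = (Measure.modularCharacterFun x : ℝ) • star (f x⁻¹) := rfl

theorem integrable_kernel (f g : Cc μ A) (x : G) : Integrable (fun t => f t * g (t⁻¹ * x)) μ :=
  integrable_conv_kernel μ f.continuous f.hasCompactSupport g.continuous x

/-- The `L¹`-norm on `C_c(G, A)`. -/
def l1Seminorm (μ : Measure G) [μ.IsHaarMeasure] (A : Type*) [NonUnitalCStarAlgebra A] :
    AddGroupSeminorm (Cc μ A) where
  toFun f := ∫ x, ‖f x‖ ∂μ
  map_zero' := by simp
  add_le' f g := by
    rw [← integral_add f.integrable.norm g.integrable.norm]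
    exact integral_mono (f + g).integrable.norm (f.integrable.norm.add g.integrable.norm)
      fun x => norm_add_le _ _
  neg' f := by simp

instance : NonUnitalSeminormedRing (Cc μ A) :=
  { (l1Seminorm μ A).toSeminormedAddCommGroup with
    left_distrib := fun f g h => by
      ext x
      simp only [mul_apply, add_apply, mul_add]
      exact integral_add (integrable_kernel f g x) (integrable_kernel f h x)
    right_distrib := fun f g h => by
      ext x
      simp only [mul_apply, add_apply, add_mul]
      exact integral_add (integrable_kernel f h x) (integrable_kernel g h x)
    zero_mul := fun f => by
      ext x
      simp [mul_apply]
    mul_zero := fun f => by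
      ext x
      simp [mul_apply]
    mul_assoc := fun f g h => by
      ext x
      exact conv_assoc μ f.continuous f.hasCompactSupport g.continuous g.hasCompactSupport
        h.continuous x
    norm_mul_le := fun f g => integral_norm_conv_le μ f.continuous f.hasCompactSupport
      g.continuous g.hasCompactSupport }

theorem norm_def (f : Cc μ A) : ‖f‖ = ∫ x, ‖f x‖ ∂μ := rfl

instance : StarRing (Cc μ A) where
  star_involutive f := by
    ext x
    exact involution_involution f x
  star_add f g := by
    ext x
    simp [star_apply]
  star_mul f g := by
    ext x
    exact involution_conv μ f g x

instance : NormedStarGroup (Cc μ A) where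
  norm_star_le f := (integral_norm_involution μ f.continuous f.hasCompactSupport).le

instance : NormedSpace ℂ (Cc μ A) where
  norm_smul_le c f := by
    simp [norm_def, norm_smul, integral_const_mul]

instance : IsScalarTower ℂ (Cc μ A) (Cc μ A) where
  smul_assoc c f g := by
    ext x
    simp [mul_apply, integral_smul, smul_mul_assoc]

instance : SMulCommClass ℂ (Cc μ A) (Cc μ A) where
  smul_comm c f g := by
    ext x
    simp [mul_apply, integral_smul, mul_smul_comm]

instance : StarModule ℂ (Cc μ A) where
  star_smul c f := by
    ext x
    rw [star_apply, smul_apply, smul_apply, star_apply, star_smul, smul_comm]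

/-- The class in `L¹(G, A)` of a function in `C_c(G, A)`. -/
def toL1 : Cc μ A →ₗᵢ[ℂ] L1 μ A where
  toFun f := (f.memLp.toLp f : Lp A 1 μ)
  map_add' f g := MemLp.toLp_add f.memLp g.memLp
  map_smul' c f := MemLp.toLp_const_smul c f.memLp
  norm_map' f := by
    change ‖(f.memLp.toLp f : Lp A 1 μ)‖ = _
    rw [L1.norm_eq_integral_norm, norm_def]
    exact integral_congr_ae (f.memLp.coeFn_toLp.fun_comp (‖·‖))

theorem denseRange_toL1 [μ.Regular] : DenseRange (toL1 : Cc μ A → L1 μ A) := by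
  have key : ∀ f : Lp A 1 μ, ∀ r > 0, ∃ g : Cc μ A, dist f (g.memLp.toLp g) < r := by
    intro f r hr
    obtain ⟨g, hle, hg, hgL, hgc⟩ := exists_cc_eLpNorm_sub_le (Lp.memLp f)
      (ε := ENNReal.ofReal (r / 2)) (by simpa using hr)
    refine ⟨⟨⟨g, hg⟩, hgc⟩, ?_⟩
    change dist f (hgL.toLp g) < r
    rw [Lp.dist_def]
    have : eLpNorm (⇑f - ⇑(hgL.toLp g)) 1 μ ≤ ENNReal.ofReal (r / 2) := by
      refine (eLpNorm_congr_ae ?_).trans_le hle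
      filter_upwards [hgL.coeFn_toLp] with x hx
      simp [hx]
    have h2 := ENNReal.toReal_mono ENNReal.ofReal_ne_top this
    rw [ENNReal.toReal_ofReal (by positivity)] at h2
    linarith
  exact Metric.denseRange_iff.2 key

end Cc

variable [μ.IsHaarMeasure] [μ.Regular]

/-! The Banach star-algebra `L¹(G, A)`: the convolution and the involution of `C_c(G, A)`,
extended by continuity. -/

instance : NonUnitalNormedRing (L1 μ A) :=
  DenseExtension.nonUnitalNormedRing (Cc.toL1 (μ := μ) (A := A)) Cc.denseRange_toL1

instance : StarRing (L1 μ A) :=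
  DenseExtension.starRing (Cc.toL1 (μ := μ) (A := A)) Cc.denseRange_toL1

instance : NormedStarGroup (L1 μ A) :=
  DenseExtension.normedStarGroup (Cc.toL1 (μ := μ) (A := A)) Cc.denseRange_toL1

instance : IsScalarTower ℂ (L1 μ A) (L1 μ A) :=
  DenseExtension.isScalarTower (Cc.toL1 (μ := μ) (A := A)) Cc.denseRange_toL1

instance : SMulCommClass ℂ (L1 μ A) (L1 μ A) :=
  DenseExtension.smulCommClass (Cc.toL1 (μ := μ) (A := A)) Cc.denseRange_toL1

instance : StarModule ℂ (L1 μ A) :=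
  DenseExtension.starModule (Cc.toL1 (μ := μ) (A := A)) Cc.denseRange_toL1

theorem toL1_mul (f g : Cc μ A) : Cc.toL1 (f * g) = Cc.toL1 f * Cc.toL1 g :=
  (DenseExtension.mulL_coe_coe Cc.toL1 Cc.denseRange_toL1 f g).symm

theorem toL1_star (f : Cc μ A) : Cc.toL1 (star f) = star (Cc.toL1 f) :=
  (DenseExtension.starL_coe Cc.toL1 Cc.denseRange_toL1 f).symm

variable (μ A) in
/-- The star-subalgebra `C_c(G, A)` of `L¹(G, A)`. -/
def ccSubalgebra : NonUnitalStarSubalgebra ℂ (L1 μ A) where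
  carrier := Set.range (Cc.toL1 (μ := μ) (A := A))
  add_mem' := by
    rintro _ _ ⟨f, rfl⟩ ⟨g, rfl⟩
    exact ⟨f + g, map_add _ f g⟩
  zero_mem' := ⟨0, map_zero _⟩
  mul_mem' := by
    rintro _ _ ⟨f, rfl⟩ ⟨g, rfl⟩
    exact ⟨f * g, toL1_mul f g⟩
  smul_mem' := by
    rintro c _ ⟨f, rfl⟩
    exact ⟨c • f, map_smul _ c f⟩
  star_mem' := by
    rintro _ ⟨f, rfl⟩
    exact ⟨star f, toL1_star f⟩

end Algebra

section ElementaryTensor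

variable {G : Type*} [MeasurableSpace G] {μ : Measure G} {A : Type*} [NonUnitalCStarAlgebra A]

/-- For `f` in `L¹(G)` and `a` in `A`, the class in `L¹(G, A)` of the function `x ↦ f(x) a`. -/
def smulConst (f : L1 μ ℂ) (a : A) : L1 μ A :=
  ((ContinuousLinearMap.toSpanSingleton ℂ a).compLp (show Lp ℂ 1 μ from f) : Lp A 1 μ)

end ElementaryTensor

end GroupL1

/-! ### The projective tensor product of Banach star-algebras -/

namespace ProjTensor

/-- The algebraic tensor product, to be equipped with the projective norm. -/
def Alg (X Y : Type*) [AddCommMonoid X] [Module ℂ X] [AddCommMonoid Y] [Module ℂ Y] : Type _ :=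
  X ⊗[ℂ] Y

section Norm

variable {X Y : Type*} [SeminormedAddCommGroup X] [NormedSpace ℂ X]
  [SeminormedAddCommGroup Y] [NormedSpace ℂ Y]

/-- The projective norm `γ(z) = inf {∑ ‖xᵢ‖ ‖yᵢ‖ | z = ∑ xᵢ ⊗ yᵢ}`. -/
def projNorm (z : X ⊗[ℂ] Y) : ℝ :=
  sInf {r | ∃ l : List (X × Y), (l.map fun p => p.1 ⊗ₜ[ℂ] p.2).sum = z ∧
    (l.map fun p => ‖p.1‖ * ‖p.2‖).sum = r}

theorem sum_nonneg (l : List (X × Y)) : 0 ≤ (l.map fun p => ‖p.1‖ * ‖p.2‖).sum := by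
  refine List.sum_nonneg fun r hr => ?_
  obtain ⟨p, -, rfl⟩ := List.mem_map.1 hr
  positivity

theorem exists_list (z : X ⊗[ℂ] Y) :
    ∃ l : List (X × Y), (l.map fun p => p.1 ⊗ₜ[ℂ] p.2).sum = z := by
  induction z with
  | zero => exact ⟨[], rfl⟩
  | tmul x y => exact ⟨[(x, y)], by simp⟩
  | add z w hz hw =>
    obtain ⟨l, rfl⟩ := hz
    obtain ⟨m, rfl⟩ := hw
    exact ⟨l ++ m, by simp⟩

theorem projNorm_nonneg (z : X ⊗[ℂ] Y) : 0 ≤ projNorm z := by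
  refine Real.sInf_nonneg ?_
  rintro _ ⟨l, -, rfl⟩
  exact sum_nonneg l

theorem projNorm_le (l : List (X × Y)) :
    projNorm (l.map fun p => p.1 ⊗ₜ[ℂ] p.2).sum ≤ (l.map fun p => ‖p.1‖ * ‖p.2‖).sum := by
  refine csInf_le ⟨0, ?_⟩ ⟨l, rfl, rfl⟩
  rintro _ ⟨m, -, rfl⟩
  exact sum_nonneg m

theorem le_projNorm {z : X ⊗[ℂ] Y} {c : ℝ}
    (h : ∀ l : List (X × Y), (l.map fun p => p.1 ⊗ₜ[ℂ] p.2).sum = z →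
      c ≤ (l.map fun p => ‖p.1‖ * ‖p.2‖).sum) : c ≤ projNorm z := by
  obtain ⟨l, hl⟩ := exists_list z
  refine le_csInf ⟨_, l, hl, rfl⟩ ?_
  rintro _ ⟨m, hm, rfl⟩
  exact h m hm

theorem projNorm_tmul_le (x : X) (y : Y) : projNorm (x ⊗ₜ[ℂ] y) ≤ ‖x‖ * ‖y‖ := by
  simpa using projNorm_le [(x, y)]

theorem projNorm_zero : projNorm (0 : X ⊗[ℂ] Y) = 0 :=
  le_antisymm (by simpa using projNorm_le ([] : List (X × Y))) (projNorm_nonneg _)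

theorem projNorm_add_le (z w : X ⊗[ℂ] Y) : projNorm (z + w) ≤ projNorm z + projNorm w := by
  rw [← sub_le_iff_le_add]
  refine le_projNorm fun l hl => ?_
  rw [sub_le_comm]
  refine le_projNorm fun m hm => ?_
  rw [sub_le_iff_le_add', ← hl, ← hm]
  simpa using projNorm_le (l ++ m)

theorem projNorm_map_le (T : X ⊗[ℂ] Y →+ X ⊗[ℂ] Y) {C : ℝ} (hC : 0 ≤ C)
    (h : ∀ x y, projNorm (T (x ⊗ₜ[ℂ] y)) ≤ C * (‖x‖ * ‖y‖)) (z : X ⊗[ℂ] Y) :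
    projNorm (T z) ≤ C * projNorm z := by
  have key : ∀ l : List (X × Y), projNorm (T (l.map fun p => p.1 ⊗ₜ[ℂ] p.2).sum) ≤
      C * (l.map fun p => ‖p.1‖ * ‖p.2‖).sum := by
    intro l
    induction l with
    | nil => simp [projNorm_zero]
    | cons p l ih =>
      simp only [List.map_cons, List.sum_cons, map_add, mul_add]
      exact (projNorm_add_le _ _).trans (add_le_add (h _ _) ih)
  rcases hC.eq_or_lt with rfl | hC
  · obtain ⟨l, rfl⟩ := exists_list z
    simpa using key l
  · rw [← div_le_iff₀' hC]
    refine le_projNorm fun l hl => ?_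
    rw [div_le_iff₀' hC, ← hl]
    exact key l

theorem projNorm_smul_le (c : ℂ) (z : X ⊗[ℂ] Y) : projNorm (c • z) ≤ ‖c‖ * projNorm z := by
  refine projNorm_map_le (DistribSMul.toAddMonoidHom _ c) (norm_nonneg c) (fun x y => ?_) z
  refine (projNorm_tmul_le (c • x) y).trans_eq ?_
  rw [norm_smul, mul_assoc]

theorem projNorm_neg (z : X ⊗[ℂ] Y) : projNorm (-z) = projNorm z := by
  have h : ∀ w : X ⊗[ℂ] Y, projNorm (-w) ≤ projNorm w := fun w => by
    simpa using projNorm_smul_le (-1) w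
  exact le_antisymm (h z) (by simpa using h (-z))

end Norm

variable {X Y : Type*}
  [NonUnitalNormedRing X] [StarRing X] [NormedStarGroup X] [NormedSpace ℂ X]
  [IsScalarTower ℂ X X] [SMulCommClass ℂ X X] [StarModule ℂ X]
  [NonUnitalNormedRing Y] [StarRing Y] [NormedStarGroup Y] [NormedSpace ℂ Y]
  [IsScalarTower ℂ Y Y] [SMulCommClass ℂ Y Y] [StarModule ℂ Y]

theorem projNorm_mul_le (z w : X ⊗[ℂ] Y) : projNorm (z * w) ≤ projNorm z * projNorm w := by
  rw [mul_comm (projNorm z)]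
  refine projNorm_map_le (AddMonoidHom.mulRight w) (projNorm_nonneg w) (fun x y => ?_) z
  rw [mul_comm (projNorm w)]
  refine projNorm_map_le (AddMonoidHom.mulLeft (x ⊗ₜ[ℂ] y)) (by positivity) (fun x' y' => ?_) w
  rw [AddMonoidHom.coe_mulLeft, Algebra.TensorProduct.tmul_mul_tmul]
  refine (projNorm_tmul_le _ _).trans ?_
  rw [mul_mul_mul_comm]
  exact mul_le_mul (norm_mul_le _ _) (norm_mul_le _ _) (norm_nonneg _) (by positivity)

theorem projNorm_star_le (z : X ⊗[ℂ] Y) : projNorm (star z) ≤ projNorm z := by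
  have := projNorm_map_le (starAddEquiv : X ⊗[ℂ] Y ≃+ X ⊗[ℂ] Y).toAddMonoidHom zero_le_one
    (fun x y => ?_) z
  · simpa using this
  · simpa using projNorm_tmul_le (star x) (star y)

theorem star_mul_tensor (z w : X ⊗[ℂ] Y) : star (z * w) = star w * star z := by
  induction z with
  | zero => simp
  | add z z' hz hz' => simp [add_mul, mul_add, hz, hz']
  | tmul x y =>
    induction w with
    | zero => simp
    | add w w' hw hw' => simp [add_mul, mul_add, hw, hw']
    | tmul x' y' => simp [Algebra.TensorProduct.tmul_mul_tmul]

namespace Alg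

instance : NonUnitalSeminormedRing (Alg X Y) :=
  { ({ toFun := projNorm
       map_zero' := projNorm_zero
       add_le' := projNorm_add_le
       neg' := projNorm_neg } : AddGroupSeminorm (X ⊗[ℂ] Y)).toSeminormedAddCommGroup,
    (inferInstance : NonUnitalRing (X ⊗[ℂ] Y)) with
    norm_mul_le := projNorm_mul_le }

instance : StarRing (Alg X Y) where
  toStar := inferInstanceAs (Star (X ⊗[ℂ] Y))
  star_involutive := star_involutive (R := X ⊗[ℂ] Y)
  star_add := star_add (R := X ⊗[ℂ] Y)
  star_mul := star_mul_tensor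

instance : NormedStarGroup (Alg X Y) where
  norm_star_le := projNorm_star_le

instance : NormedSpace ℂ (Alg X Y) :=
  { (inferInstanceAs (Module ℂ (X ⊗[ℂ] Y)) : Module ℂ (X ⊗[ℂ] Y)) with
    norm_smul_le := projNorm_smul_le }

instance : IsScalarTower ℂ (Alg X Y) (Alg X Y) :=
  inferInstanceAs (IsScalarTower ℂ (X ⊗[ℂ] Y) (X ⊗[ℂ] Y))

instance : SMulCommClass ℂ (Alg X Y) (Alg X Y) :=
  inferInstanceAs (SMulCommClass ℂ (X ⊗[ℂ] Y) (X ⊗[ℂ] Y))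

instance : StarModule ℂ (Alg X Y) :=
  inferInstanceAs (StarModule ℂ (X ⊗[ℂ] Y))

end Alg

end ProjTensor

/-- The projective tensor product `X ⊗_γ Y`: the completion of the algebraic tensor product for the
projective norm. -/
def ProjTensor (X Y : Type*) [NonUnitalNormedRing X] [StarRing X] [NormedStarGroup X]
    [NormedSpace ℂ X] [IsScalarTower ℂ X X] [SMulCommClass ℂ X X] [StarModule ℂ X]
    [NonUnitalNormedRing Y] [StarRing Y] [NormedStarGroup Y] [NormedSpace ℂ Y]
    [IsScalarTower ℂ Y Y] [SMulCommClass ℂ Y Y] [StarModule ℂ Y] : Type _ :=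
  UniformSpace.Completion (ProjTensor.Alg X Y)

namespace ProjTensor

variable {X Y : Type*}
  [NonUnitalNormedRing X] [StarRing X] [NormedStarGroup X] [NormedSpace ℂ X]
  [IsScalarTower ℂ X X] [SMulCommClass ℂ X X] [StarModule ℂ X]
  [NonUnitalNormedRing Y] [StarRing Y] [NormedStarGroup Y] [NormedSpace ℂ Y]
  [IsScalarTower ℂ Y Y] [SMulCommClass ℂ Y Y] [StarModule ℂ Y]

instance : NormedAddCommGroup (ProjTensor X Y) :=
  inferInstanceAs (NormedAddCommGroup (UniformSpace.Completion (Alg X Y)))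

instance : NormedSpace ℂ (ProjTensor X Y) :=
  inferInstanceAs (NormedSpace ℂ (UniformSpace.Completion (Alg X Y)))

instance : CompleteSpace (ProjTensor X Y) :=
  inferInstanceAs (CompleteSpace (UniformSpace.Completion (Alg X Y)))

/-- The canonical map from the algebraic tensor product to its completion. -/
def ofAlg : Alg X Y →ₗᵢ[ℂ] ProjTensor X Y :=
  (UniformSpace.Completion.toComplₗᵢ : Alg X Y →ₗᵢ[ℂ] UniformSpace.Completion (Alg X Y))

theorem denseRange_ofAlg : DenseRange (ofAlg : Alg X Y → ProjTensor X Y) :=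
  UniformSpace.Completion.denseRange_coe (α := Alg X Y)

instance : NonUnitalNormedRing (ProjTensor X Y) :=
  DenseExtension.nonUnitalNormedRing (ofAlg (X := X) (Y := Y)) denseRange_ofAlg

instance : StarRing (ProjTensor X Y) :=
  DenseExtension.starRing (ofAlg (X := X) (Y := Y)) denseRange_ofAlg

instance : NormedStarGroup (ProjTensor X Y) :=
  DenseExtension.normedStarGroup (ofAlg (X := X) (Y := Y)) denseRange_ofAlg

instance : IsScalarTower ℂ (ProjTensor X Y) (ProjTensor X Y) :=
  DenseExtension.isScalarTower (ofAlg (X := X) (Y := Y)) denseRange_ofAlg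

instance : SMulCommClass ℂ (ProjTensor X Y) (ProjTensor X Y) :=
  DenseExtension.smulCommClass (ofAlg (X := X) (Y := Y)) denseRange_ofAlg

instance : StarModule ℂ (ProjTensor X Y) :=
  DenseExtension.starModule (ofAlg (X := X) (Y := Y)) denseRange_ofAlg

/-- The elementary tensor `x ⊗ y` in the projective tensor product. -/
def tmul (x : X) (y : Y) : ProjTensor X Y := ofAlg (show Alg X Y from x ⊗ₜ[ℂ] y)

theorem tmul_mul_tmul (x x' : X) (y y' : Y) :
    tmul x y * tmul x' y' = tmul (x * x') (y * y') :=
  (DenseExtension.mulL_coe_coe ofAlg denseRange_ofAlg _ _).trans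
    (congrArg ofAlg (Algebra.TensorProduct.tmul_mul_tmul x x' y y'))

theorem star_tmul (x : X) (y : Y) : star (tmul x y) = tmul (star x) (star y) :=
  DenseExtension.starL_coe ofAlg denseRange_ofAlg _

end ProjTensor

/-! ### Quasi-symmetry and growth -/

/-- A star-subalgebra `S` of a star-algebra `B` is quasi-symmetric in `B` if the spectrum of `a^* a`
in `B` is contained in `[0, ∞)` for every `a` in `S`. The spectrum is taken in the unitization of
`B`; if `B` has a unit this only adds the point `0` to the spectrum in `B`. -/
def IsQuasiSymmetric {B : Type*} [NonUnitalRing B] [StarRing B] [Module ℂ B]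
    (S : NonUnitalStarSubalgebra ℂ B) : Prop :=
  ∀ a ∈ S, quasispectrum ℂ (star a * a) ⊆ Complex.ofReal '' Set.Ici 0

/-- A group with Haar measure `μ` has subexponential growth if for every compact `K` and every
`t > 0` there is `C > 0` with `μ (K ^ n) ≤ C exp (t n)` for all `n`. -/
def HasSubexponentialGrowth {G : Type*} [Group G] [TopologicalSpace G] [MeasurableSpace G]
    (μ : Measure G) : Prop :=
  ∀ K : Set G, IsCompact K → ∀ t : ℝ, 0 < t → ∃ C : ℝ, 0 < C ∧
    ∀ n : ℕ, μ (K ^ n) ≤ ENNReal.ofReal (C * Real.exp (t * n))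

end

noncomputable section

/-! ### A criterion for quasi-symmetry -/

section Criterion

open Polynomial Filter Topology

/-! Quasi-symmetry rests on comparing two norms on `C_c(G, A)`: the `L¹` norm, and the operator norm
of left convolution `λ` on the Hilbert module `L²(G, A)`, whose completion is a C⋆-algebra. Let `b`
have support `K`. Then `b^(n+2) = b * b^(n+1)` lives on `K^(n+2)`. Its values are inner products of
`star b` with right translates of `b^(n+1)`. Subexponential growth forces `G` to be unimodular, so
Cauchy–Schwarz bounds these values by `‖star b‖₂ ‖b‖₂ ‖λ(b)‖^n`. Multiplying by `μ(K^(n+2)) ≤ C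
exp(t(n+2))` bounds the `L¹` norm of `b^(n+2)` by a constant times `(exp(t) ‖λ(b)‖)^n`
(`Cc.exists_norm_iterate_mul_le`). Since `t` is arbitrary, the spectral radius of `b` in `L¹(G, A)`
is at most `‖λ(b)‖`.

Apply this to `b = p(star f * f)` for a polynomial `p` with `p(0) = 0`: every `z` in the spectrum of
`star f * f` satisfies `|p(z)| ≤ ‖p(λ(star f * f))‖` (`norm_eval_le_of_iterate_bound`). The element
`λ(star f * f)` is positive in a C⋆-algebra, so the right side is at most the supremum of `|p|` on a
bounded interval `[0, M]`. If `z` is off the half-line, `exists_polynomial_bound` supplies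
polynomials with `p(z) = z` that are uniformly small on `[0, M]`; hence `z = 0`, a contradiction.

For the tensor product, the bilinear map `(f, a) ↦ f(·)a` induces a contraction `ofTensor` into
`L¹(G, A)`. In the other direction, `1_s a ↦ 1_s ⊗ a` is additive in `s` and bounded by `μ(s) ‖a‖`,
so it extends from simple functions to a contraction `toTensor`. The two are mutually inverse, hence
isometric. Product and involution are compared on elementary tensors of functions in `C_c(G)` and
carried over by density. -/

/-- Otherwise `(x/y)^n` would be unbounded. The shift `k` absorbs the finitely many factors that do
not enter the growth rate. -/
theorem le_of_forall_pow_add_le_mul_pow {x y C : ℝ} (k : ℕ) (hy : 0 ≤ y)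
    (h : ∀ n : ℕ, x ^ (n + k) ≤ C * y ^ n) : x ≤ y := by
  by_contra! hlt
  have hx0 : 0 < x := hy.trans_lt hlt
  rcases hy.eq_or_lt with rfl | hy0
  -- The case `n = 0` says nothing here, since `0 ^ 0 = 1`.
  · have := h 1
    have h2 : 0 < x ^ (1 + k) := by positivity
    simp only [pow_one, mul_zero] at this
    linarith
  · obtain ⟨n, hn⟩ := pow_unbounded_of_one_lt (C / x ^ k) ((one_lt_div hy0).2 hlt)
    have := h n
    rw [div_pow, div_lt_div_iff₀ (by positivity) (by positivity)] at hn
    rw [pow_add] at this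
    linarith

theorem le_of_forall_le_exp_mul {x s : ℝ} (h : ∀ t : ℝ, 0 < t → x ≤ Real.exp t * s) : x ≤ s := by
  have h1 : Tendsto (fun t : ℝ => Real.exp t * s) (𝓝[>] 0) (𝓝 (Real.exp 0 * s)) :=
    ((Real.continuous_exp.mul continuous_const).tendsto 0).mono_left nhdsWithin_le_nhds
  rw [Real.exp_zero, one_mul] at h1
  exact ge_of_tendsto h1 (eventually_mem_nhdsWithin.mono fun t ht => h t ht)

theorem map_iterate_mul_left {D R : Type*} [Mul D] [Monoid R] (φ : D → R)
    (hφ : ∀ a b, φ (a * b) = φ a * φ b) (b : D) (n : ℕ) :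
    φ ((b * ·)^[n] b) = φ b ^ (n + 1) := by
  induction n with
  | zero => simp
  | succ n ih => rw [Function.iterate_succ_apply', hφ, ih, ← pow_succ']

/-- The polynomial is `w (1 - c (w - z)(w - z̄))^k`. It fixes `z`, vanishes at `0`, and on the real
line the bracket equals `1 - c |t - z|²`, which a small `c` keeps between `0` and some `ρ < 1` on
`[0, M]`. -/
theorem exists_polynomial_bound {z : ℂ} (hz : z ∉ Complex.ofReal '' Set.Ici 0) {M : ℝ}
    (hM : 0 ≤ M) : ∃ ρ : ℝ, 0 ≤ ρ ∧ ρ < 1 ∧ ∀ k : ℕ, ∃ p : ℂ[X], p.eval 0 = 0 ∧ p.eval z = z ∧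
      ∀ t : ℝ, 0 ≤ t → t ≤ M → ‖p.eval (t : ℂ)‖ ≤ M * ρ ^ k := by
  have hcl : IsClosed (Complex.ofReal '' Set.Ici 0) :=
    Complex.isometry_ofReal.isClosedEmbedding.isClosedMap _ isClosed_Ici
  obtain ⟨δ, hδ, hball⟩ := Metric.isOpen_iff.1 hcl.isOpen_compl z hz
  have hdist : ∀ t : ℝ, 0 ≤ t → δ ≤ ‖(t : ℂ) - z‖ := fun t ht => by
    by_contra! hlt
    exact hball (by simpa [dist_eq_norm] using hlt) ⟨t, ht, rfl⟩
  have hz0 : δ ≤ ‖z‖ := by simpa using hdist 0 le_rfl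
  have hz1 : 0 < ‖z‖ := hδ.trans_le hz0
  -- On `[0, M]` one has `|t - z| ≤ M + |z|`, so this `c` keeps the bracket nonnegative; the
  -- distance `δ` from `z` to the half-line keeps it below `1 - c δ²`.
  set c : ℝ := ((M + ‖z‖) ^ 2)⁻¹ with hc
  have hc0 : 0 < c := by positivity
  have hq : ∀ t : ℝ, 0 ≤ t → t ≤ M → c * ‖(t : ℂ) - z‖ ^ 2 ≤ 1 := fun t ht htM => by
    rw [hc, inv_mul_le_iff₀ (by positivity), mul_one]
    refine pow_le_pow_left₀ (norm_nonneg _) ((norm_sub_le _ _).trans ?_) 2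
    rw [Complex.norm_of_nonneg ht]
    gcongr
  have hq' : ∀ t : ℝ, 0 ≤ t → c * δ ^ 2 ≤ c * ‖(t : ℂ) - z‖ ^ 2 := fun t ht => by
    have := hdist t ht
    gcongr
  refine ⟨1 - c * δ ^ 2, ?_, ?_, fun k => ?_⟩
  · linarith [hq 0 le_rfl hM, hq' 0 le_rfl]
  · have : 0 < c * δ ^ 2 := by positivity
    linarith
  refine ⟨X * (1 - C (c : ℂ) * ((X - C z) * (X - C (starRingEnd ℂ z)))) ^ k,
    by simp, by simp, fun t ht htM => ?_⟩
  have hev : (1 - (c : ℂ) * (((t : ℂ) - z) * ((t : ℂ) - starRingEnd ℂ z))) =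
      ((1 - c * ‖(t : ℂ) - z‖ ^ 2 : ℝ) : ℂ) := by
    have : (t : ℂ) - starRingEnd ℂ z = starRingEnd ℂ ((t : ℂ) - z) := by simp
    rw [this, Complex.mul_conj, Complex.normSq_eq_norm_sq]
    push_cast
    ring
  simp only [eval_mul, eval_X, eval_pow, eval_sub, eval_one, eval_C]
  rw [hev, norm_mul, norm_pow, Complex.norm_of_nonneg ht,
    Complex.norm_of_nonneg (by linarith [hq t ht htM])]
  have h1 := hq t ht htM
  have h2 := hq' t ht
  gcongr

variable {D B E : Type*} [NonUnitalRing D] [Module ℂ D] [IsScalarTower ℂ D D]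
  [SMulCommClass ℂ D D] [NonUnitalNormedRing B] [NormedSpace ℂ B] [CompleteSpace B]
  [IsScalarTower ℂ B B] [SMulCommClass ℂ B B] [NonUnitalCStarAlgebra E]

/-- The hypothesis bounds the spectral radius of `ι b` by `‖π b‖` for every `b`. Applied to `b =
p(a)`, it combines with spectral mapping for `p`. The iterate `(b * ·)^[n + 1] b` stands for
`b^(n+2)`, as `D` has no unit. -/
theorem norm_eval_le_of_iterate_bound (ι : D →ₙₐ[ℂ] B) (π : D →ₙₐ[ℂ] E)
    (h : ∀ b : D, ∀ t : ℝ, 0 < t → ∃ C : ℝ, ∀ n : ℕ,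
      ‖ι ((b * ·)^[n + 1] b)‖ ≤ C * (Real.exp t * ‖π b‖) ^ n)
    (a : D) {p : ℂ[X]} (hp : p.eval 0 = 0) {z : ℂ}
    (hz : z ∈ spectrum ℂ (ι a : Unitization ℂ B)) :
    ‖p.eval z‖ ≤ ‖aeval (π a : Unitization ℂ E) p‖ := by
  -- The `ℓ¹` norm makes the unitization of `B` a Banach algebra in which `B` sits isometrically.
  let ιU : Unitization ℂ D →ₐ[ℂ] WithLp 1 (Unitization ℂ B) :=
    ((WithLp.unitizationAlgEquiv (𝕜 := ℂ) (A := B) ℂ).symm : _ →ₐ[ℂ] _).comp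
      ((Unitization.inrNonUnitalAlgHom ℂ B).comp ι).toAlgHom
  let πU : Unitization ℂ D →ₐ[ℂ] Unitization ℂ E :=
    ((Unitization.inrNonUnitalAlgHom ℂ E).comp π).toAlgHom
  have hι : ∀ d : D, ιU (d : Unitization ℂ D) = WithLp.toLp 1 (ι d : Unitization ℂ B) := fun d => by
    simp [ιU, NonUnitalAlgHom.toAlgHom]
    rfl
  have hπ : ∀ d : D, πU (d : Unitization ℂ D) = (π d : Unitization ℂ E) := fun d => by
    simp [πU, NonUnitalAlgHom.toAlgHom]
  set P : Unitization ℂ D := aeval (a : Unitization ℂ D) p with hP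
  -- Since `p(0) = 0`, the element `p(a)` has no scalar part and lies in `D`.
  obtain ⟨b, hb⟩ : ∃ b : D, P = (b : Unitization ℂ D) := by
    refine ⟨P.snd, Unitization.ext ?_ rfl⟩
    have : Unitization.fstHom ℂ D P = p.eval 0 := by
      rw [hP, ← Polynomial.aeval_algHom_apply]
      have h0 : Unitization.fstHom ℂ D (a : Unitization ℂ D) = 0 := rfl
      rw [h0, Polynomial.coe_aeval_eq_eval]
    simpa [hp] using this
  have hzU : z ∈ spectrum ℂ (ιU (a : Unitization ℂ D)) := by
    rw [hι]
    rwa [← AlgEquiv.spectrum_eq (WithLp.unitizationAlgEquiv (𝕜 := ℂ) (A := B) ℂ)]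
  have hpz : p.eval z ∈ spectrum ℂ (ιU (b : Unitization ℂ D)) := by
    rw [← hb, hP, ← Polynomial.aeval_algHom_apply]
    exact spectrum.subset_polynomial_aeval _ _ ⟨z, hzU, rfl⟩
  have hπb : aeval (π a : Unitization ℂ E) p = (π b : Unitization ℂ E) := by
    rw [← hπ, ← hπ, Polynomial.aeval_algHom_apply, ← hP, hb]
  rw [hπb, Unitization.norm_inr]
  refine le_of_forall_le_exp_mul fun t ht => ?_
  obtain ⟨K, hK⟩ := h b t ht
  refine le_of_forall_pow_add_le_mul_pow (C := K * ‖(1 : WithLp 1 (Unitization ℂ B))‖) 2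
    (by positivity) fun n => ?_
  have h1 : p.eval z ^ (n + 2) ∈ spectrum ℂ (ιU (b : Unitization ℂ D) ^ (n + 2)) :=
    spectrum.pow_mem_pow _ _ hpz
  have h2 : ιU (b : Unitization ℂ D) ^ (n + 2) =
      WithLp.toLp 1 (ι ((b * ·)^[n + 1] b) : Unitization ℂ B) := by
    rw [← hι]
    exact (map_iterate_mul_left (fun d : D => ιU (d : Unitization ℂ D))
      (fun x y => by simp) b (n + 1)).symm
  rw [h2] at h1
  have h3 := spectrum.norm_le_norm_mul_of_mem h1
  rw [norm_pow, WithLp.unitization_norm_inr] at h3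
  calc ‖p.eval z‖ ^ (n + 2) ≤ _ := h3
    _ ≤ K * (Real.exp t * ‖π b‖) ^ n * ‖(1 : WithLp 1 (Unitization ℂ B))‖ := by
        gcongr
        exact hK n
    _ = _ := by ring

/-- If the norms in `B` of the powers of every `b` in `D` grow no faster than those of the powers of
`‖π b‖`, for a star-homomorphism `π` to a C⋆-algebra, then `star f * f` has nonnegative spectrum in
`B` for every `f` in `D`. -/
theorem quasispectrum_star_mul_self_subset [StarRing D] (ι : D →ₙₐ[ℂ] B) (π : D →⋆ₙₐ[ℂ] E)
    (h : ∀ b : D, ∀ t : ℝ, 0 < t → ∃ C : ℝ, ∀ n : ℕ,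
      ‖ι ((b * ·)^[n + 1] b)‖ ≤ C * (Real.exp t * ‖π b‖) ^ n) (f : D) :
    quasispectrum ℂ (ι (star f * f)) ⊆ Complex.ofReal '' Set.Ici 0 := by
  intro z hz
  rw [Unitization.quasispectrum_eq_spectrum_inr] at hz
  by_contra hzn
  set u : Unitization ℂ E := (π f : Unitization ℂ E) with hu
  set T := star u * u with hT
  have hπT : ((π (star f * f) : E) : Unitization ℂ E) = T := by
    rw [hT, hu, map_mul, map_star, Unitization.inr_mul, Unitization.inr_star]
  have hsa : IsSelfAdjoint T := IsSelfAdjoint.star_mul_self u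
  have hspec : ∀ w ∈ spectrum ℂ T, ∃ t : ℝ, 0 ≤ t ∧ t ≤ ‖T‖ ∧ w = t := by
    intro w hw
    have hwr : w = (w.re : ℂ) := hsa.mem_spectrum_eq_re hw
    have hw' : w.re ∈ spectrum ℝ T := by
      rw [hwr] at hw
      exact (spectrum.algebraMap_mem_iff ℂ).1 hw
    have h0 := spectrum_star_mul_self_nonneg _ hw'
    refine ⟨w.re, h0, ?_, hwr⟩
    have := spectrum.norm_le_norm_of_mem hw'
    rwa [Real.norm_of_nonneg h0] at this
  obtain ⟨ρ, hρ0, hρ1, hρ⟩ := exists_polynomial_bound hzn (norm_nonneg T)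
  have hle : ∀ k : ℕ, ‖z‖ ≤ ‖T‖ * ρ ^ k := fun k => by
    obtain ⟨p, hp0, hpz, hpt⟩ := hρ k
    have h1 := norm_eval_le_of_iterate_bound ι (π : D →ₙₐ[ℂ] E) h _ hp0 hz
    change _ ≤ ‖aeval ((π (star f * f) : E) : Unitization ℂ E) p‖ at h1
    -- By functional calculus, the norm of `p(T)` is controlled by `|p|` on the spectrum of `T`, a
    -- subset of `[0, ‖T‖]`.
    rw [hpz, hπT, ← cfc_polynomial p T hsa.isStarNormal] at h1
    refine h1.trans (norm_cfc_le (by positivity) fun w hw => ?_)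
    obtain ⟨t, ht, htM, rfl⟩ := hspec w hw
    exact hpt t ht htM
  have hlim : Tendsto (fun k : ℕ => ‖T‖ * ρ ^ k) atTop (𝓝 (‖T‖ * 0)) :=
    (tendsto_pow_atTop_nhds_zero_of_lt_one hρ0 hρ1).const_mul _
  have hz0 : z = 0 := by
    have := ge_of_tendsto' hlim hle
    rw [mul_zero] at this
    exact norm_le_zero_iff.1 this
  exact hzn ⟨0, Set.self_mem_Ici, by simp [hz0]⟩

end Criterion

/-! ### The reduced C⋆-algebra of a group with coefficients in a C⋆-algebra -/

namespace GroupL1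

/-! ### Inversion and right translation in vector-valued integrals. -/

section VectorModular

variable {G : Type*} [Group G] [TopologicalSpace G] [IsTopologicalGroup G]
  [LocallyCompactSpace G] [MeasurableSpace G] [BorelSpace G]
  {E : Type*} [NormedAddCommGroup E] [NormedSpace ℝ E] [CompleteSpace E]

/-- Continuous real functionals separate points and commute with the integral, which reduces the
identity to the real-valued one. -/
theorem integral_modular_smul_inv (μ : Measure G) [μ.IsHaarMeasure] {f : G → E} (hf : Continuous f)
    (hfc : HasCompactSupport f) :
    ∫ x, (Measure.modularCharacterFun x : ℝ) • f x⁻¹ ∂μ = ∫ x, f x ∂μ := by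
  have hfi : HasCompactSupport fun x => f x⁻¹ := hfc.comp_homeomorph (Homeomorph.inv G)
  have hm := continuous_modularCharacterFun (G := G)
  rw [SeparatingDual.eq_iff_forall_dual_eq (R := ℝ)]
  intro φ
  have hint : Integrable (fun x => (Measure.modularCharacterFun x : ℝ) • f x⁻¹) μ :=
    Continuous.integrable_of_hasCompactSupport (by fun_prop) hfi.smul_left
  rw [← φ.integral_comp_comm (hf.integrable_of_hasCompactSupport hfc),
    ← φ.integral_comp_comm hint]
  simpa using integral_modular_inv μ (f := fun x => φ (f x)) (φ.continuous.comp hf)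
    (hfc.comp_left (map_zero φ))

theorem integral_mul_right_eq_smul (μ : Measure G) [μ.IsHaarMeasure] {f : G → E}
    (hf : Continuous f) (hfc : HasCompactSupport f) (g : G) :
    ∫ x, f (x * g) ∂μ = (Measure.modularCharacterFun g : ℝ) • ∫ x, f x ∂μ := by
  have hfi : HasCompactSupport fun x => f (x * g) := hfc.comp_homeomorph (Homeomorph.mulRight g)
  rw [SeparatingDual.eq_iff_forall_dual_eq (R := ℝ)]
  intro φ
  have hint : Integrable (fun x => f (x * g)) μ :=
    Continuous.integrable_of_hasCompactSupport (by fun_prop) hfi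
  rw [map_smul, ← φ.integral_comp_comm (hf.integrable_of_hasCompactSupport hfc),
    ← φ.integral_comp_comm hint]
  exact integral_mul_right_eq μ (f := fun x => φ (f x)) (φ.continuous.comp hf)
    (hfc.comp_left (map_zero φ)) g

end VectorModular

variable {G : Type*} [Group G] [TopologicalSpace G] [IsTopologicalGroup G]
  [LocallyCompactSpace G] [T2Space G] [MeasurableSpace G] [BorelSpace G]
  {μ : Measure G} [μ.IsHaarMeasure] {A : Type*} [NonUnitalCStarAlgebra A]

/-! ### The `A`-valued inner product and the Hilbert module norm. -/

namespace Cc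

/-- The `A`-valued inner product `∫ ξ(x)^* η(x) dx` on `C_c(G, A)`. -/
def inner (ξ η : Cc μ A) : A := (star ξ * η) 1

theorem integrable_star_mul (ξ η : Cc μ A) : Integrable (fun x => star (ξ x) * η x) μ :=
  Continuous.integrable_of_hasCompactSupport (ξ.continuous.star.mul η.continuous)
    η.hasCompactSupport.mul_left

/-- Defining the inner product as a value of a convolution makes adjointness (`inner_mul_left`) a
matter of associativity. The integral form, obtained by the substitution `x ↦ x⁻¹`, is the one that
shows positivity. -/
theorem inner_eq_integral (ξ η : Cc μ A) : inner ξ η = ∫ x, star (ξ x) * η x ∂μ := by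
  rw [← integral_modular_smul_inv μ (f := fun x => star (ξ x) * η x)
    (ξ.continuous.star.mul η.continuous) η.hasCompactSupport.mul_left, inner, mul_apply]
  simp [star_apply, smul_mul_assoc]

theorem inner_add_right (ξ η ζ : Cc μ A) : inner ξ (η + ζ) = inner ξ η + inner ξ ζ := by
  simp [inner, mul_add]

theorem inner_add_left (ξ η ζ : Cc μ A) : inner (ξ + η) ζ = inner ξ ζ + inner η ζ := by
  simp [inner, add_mul]

theorem inner_neg_neg (ξ : Cc μ A) : inner (-ξ) (-ξ) = inner ξ ξ := by
  simp [inner]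

theorem inner_smul_smul (c : ℂ) (ξ : Cc μ A) :
    inner (c • ξ) (c • ξ) = (star c * c) • inner ξ ξ := by
  simp [inner, smul_mul_assoc, mul_smul_comm, smul_smul, mul_comm]

theorem inner_mul_left (f ξ η : Cc μ A) : inner (f * ξ) η = inner ξ (star f * η) := by
  simp [inner, mul_assoc]

theorem star_inner (ξ η : Cc μ A) : star (inner ξ η) = inner η ξ := by
  have h : star η * ξ = star (star ξ * η) := by simp
  rw [inner, inner, h, star_apply]
  simp [Measure.modularCharacterFun_map_one]

/-- The function `x ↦ ξ(x) a`. -/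
def mulRightConst (ξ : Cc μ A) (a : A) : Cc μ A :=
  ⟨⟨fun x => ξ x * a, ξ.continuous.mul_const a⟩, ξ.hasCompactSupport.mul_right⟩

theorem mulRightConst_apply (ξ : Cc μ A) (a : A) (x : G) : mulRightConst ξ a x = ξ x * a := rfl

theorem inner_mulRightConst (ξ η : Cc μ A) (a : A) :
    inner ξ (mulRightConst η a) = inner ξ η * a := by
  simp only [inner_eq_integral, mulRightConst_apply]
  rw [integral_mul_const' μ (integrable_star_mul ξ η)]
  simp [mul_assoc]

theorem inner_mulRightConst_left (ξ η : Cc μ A) (a : A) :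
    inner (mulRightConst ξ a) η = star a * inner ξ η := by
  rw [← star_inner, inner_mulRightConst, star_mul, star_inner]

/-- The function `x ↦ a ξ(t⁻¹ x)`. -/
def translate (a : A) (t : G) (ξ : Cc μ A) : Cc μ A :=
  ⟨⟨fun x => a * ξ (t⁻¹ * x), (ξ.continuous.comp (continuous_const_mul t⁻¹)).const_mul a⟩,
    HasCompactSupport.mul_left (ξ.hasCompactSupport.comp_homeomorph (Homeomorph.mulLeft t⁻¹))⟩

theorem translate_apply (a : A) (t : G) (ξ : Cc μ A) (x : G) :
    translate a t ξ x = a * ξ (t⁻¹ * x) := rfl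

/-- The function `x ↦ ξ(x g)`. -/
def translateRight (g : G) (ξ : Cc μ A) : Cc μ A :=
  ⟨⟨fun x => ξ (x * g), ξ.continuous.comp (continuous_mul_const g)⟩,
    ξ.hasCompactSupport.comp_homeomorph (Homeomorph.mulRight g)⟩

theorem translateRight_apply (g : G) (ξ : Cc μ A) (x : G) : translateRight g ξ x = ξ (x * g) := rfl

theorem inner_translateRight (g : G) (ξ η : Cc μ A) :
    inner (translateRight g ξ) (translateRight g η) =
      (Measure.modularCharacterFun g : ℝ) • inner ξ η := by
  simp only [inner_eq_integral, translateRight_apply]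
  exact integral_mul_right_eq_smul μ (f := fun x => star (ξ x) * η x)
    (ξ.continuous.star.mul η.continuous) η.hasCompactSupport.mul_left g

theorem mul_apply_eq_inner (f g : Cc μ A) (x : G) :
    (f * g) x = inner (star f) (translateRight x g) := by
  simp [inner, mul_apply, translateRight_apply]

/-- By Fubini, `f * ξ` is weakly a superposition of translates of `ξ`. This allows an estimate of
convolution without integrating in the completion of `L²`. -/
theorem inner_mul_right (η f ξ : Cc μ A) :
    inner η (f * ξ) = ∫ t, inner η (translate (f t) t ξ) ∂μ := by
  simp only [inner_eq_integral, translate_apply]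
  have h1 : ∀ x, star (η x) * (f * ξ) x = ∫ t, star (η x) * (f t * ξ (t⁻¹ * x)) ∂μ := fun x =>
    integral_const_mul' μ (integrable_kernel f ξ x) _
  simp only [h1]
  refine integral_integral_swap_of_hasCompactSupport
    (f := fun x t => star (η x) * (f t * ξ (t⁻¹ * x))) ?_ ?_
  · have := f.continuous
    have := η.continuous
    have := ξ.continuous
    fun_prop
  · refine hasCompactSupport_kernel η.hasCompactSupport f.hasCompactSupport fun x t hne => ?_
    exact ⟨subset_tsupport _ (star_ne_zero.1 (left_ne_zero_of_mul hne)),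
      subset_tsupport _ (left_ne_zero_of_mul (right_ne_zero_of_mul hne))⟩

section Order

variable [PartialOrder A] [StarOrderedRing A]

theorem inner_self_nonneg (ξ : Cc μ A) : 0 ≤ inner ξ ξ := by
  rw [inner_eq_integral]
  exact integral_nonneg fun x => star_mul_self_nonneg (ξ x)

/-- Left invariance removes the translation; pointwise, `star a * a` is at most `‖a‖²` under
conjugation. -/
theorem inner_translate_le (a : A) (t : G) (ξ : Cc μ A) :
    inner (translate a t ξ) (translate a t ξ) ≤ ‖a‖ ^ 2 • inner ξ ξ := by
  have h : inner (translate a t ξ) (translate a t ξ) =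
      ∫ x, star (ξ x) * (star a * a) * ξ x ∂μ := by
    rw [inner_eq_integral, ← integral_mul_left_eq_self
      (fun x => star (ξ x) * (star a * a) * ξ x) t⁻¹]
    simp [translate_apply, mul_assoc]
  rw [h, inner_eq_integral, ← integral_smul]
  refine integral_mono ?_ ((integrable_star_mul ξ ξ).smul _) fun x => ?_
  · refine Continuous.integrable_of_hasCompactSupport ?_ ξ.hasCompactSupport.mul_left
    exact (ξ.continuous.star.mul_const _).mul ξ.continuous
  · refine (CStarAlgebra.star_left_conjugate_le_norm_smul
      (IsSelfAdjoint.star_mul_self a)).trans_eq ?_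
    rw [CStarRing.norm_star_mul_self, sq]

/-- Expand the positive element `⟨η - s ξa, η - s ξa⟩` with `a = ⟨ξ, η⟩`, and use `star a * ⟨ξ, ξ⟩ *
a ≤ ‖⟨ξ, ξ⟩‖ • (star a * a)`. The parameter `s` is optimized once norms are taken. -/
theorem smul_star_mul_self_le (ξ η : Cc μ A) (s : ℝ) :
    (2 * s - s ^ 2 * ‖inner ξ ξ‖) • (star (inner ξ η) * inner ξ η) ≤ inner η η := by
  set a := inner ξ η with ha
  have h0 := inner_self_nonneg (mulRightConst ξ ((-s) • a) + η)
  have h1 : inner (mulRightConst ξ ((-s) • a) + η) (mulRightConst ξ ((-s) • a) + η) =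
      s ^ 2 • (star a * inner ξ ξ * a) - (2 * s) • (star a * a) + inner η η := by
    have e2 : inner η ξ = star a := by rw [ha, star_inner]
    simp only [inner_add_left, inner_add_right, inner_mulRightConst, inner_mulRightConst_left,
      e2, ← ha, star_smul, smul_mul_assoc, mul_smul_comm, mul_assoc, add_mul, star_trivial]
    module
  have h2 : star a * inner ξ ξ * a ≤ ‖inner ξ ξ‖ • (star a * a) :=
    CStarAlgebra.star_left_conjugate_le_norm_smul (star_inner ξ ξ)
  rw [h1] at h0
  have h3 : s ^ 2 • (star a * inner ξ ξ * a) ≤ s ^ 2 • (‖inner ξ ξ‖ • (star a * a)) :=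
    smul_le_smul_of_nonneg_left h2 (sq_nonneg s)
  rw [← sub_nonneg]
  refine (add_nonneg h0 (sub_nonneg.2 h3)).trans_eq ?_
  module

end Order

theorem le_mul_of_forall_quadratic {q M N : ℝ} (hq : 0 ≤ q) (hN : 0 ≤ N) (hM : 0 ≤ M)
    (h : ∀ s : ℝ, (2 * s - s ^ 2 * N) * q ≤ M) : q ≤ N * M := by
  rcases hN.eq_or_lt with rfl | hN
  · rcases hq.eq_or_lt with rfl | hq
    · simp
    -- With `N = 0` the left side is linear in `s`, so a large `s` contradicts the bound; for `N >
    -- 0` the maximum is at `s = 1 / N`.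
    · have := h ((M + 1) / q)
      have h2 : (2 * ((M + 1) / q) - ((M + 1) / q) ^ 2 * 0) * q = 2 * (M + 1) := by
        field_simp
        ring
      linarith
  · have := h (1 / N)
    have h2 : (2 * (1 / N) - (1 / N) ^ 2 * N) * q = q / N := by
      field_simp
      ring
    rw [h2, div_le_iff₀ hN] at this
    linarith

/-- The Cauchy–Schwarz inequality. -/
theorem norm_inner_sq_le (ξ η : Cc μ A) :
    ‖inner ξ η‖ ^ 2 ≤ ‖inner ξ ξ‖ * ‖inner η η‖ := by
  let := CStarAlgebra.spectralOrder A
  have := CStarAlgebra.spectralOrderedRing A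
  refine le_mul_of_forall_quadratic (by positivity) (norm_nonneg _) (norm_nonneg _) fun s => ?_
  -- Monotonicity of the norm needs a nonnegative coefficient; with a negative one the claim is
  -- trivial.
  by_cases hs : 0 ≤ 2 * s - s ^ 2 * ‖inner ξ ξ‖
  · have := CStarAlgebra.norm_le_norm_of_nonneg_of_le
      (smul_nonneg hs (star_mul_self_nonneg (inner ξ η))) (smul_star_mul_self_le ξ η s)
    rwa [norm_smul, CStarRing.norm_star_mul_self, Real.norm_of_nonneg hs, ← sq] at this
  · exact (mul_nonpos_of_nonpos_of_nonneg (not_le.1 hs).le (by positivity)).trans (norm_nonneg _)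

/-- The norm of the Hilbert module `L²(G, A)`. -/
def norm₂ (ξ : Cc μ A) : ℝ := √‖inner ξ ξ‖

theorem norm₂_nonneg (ξ : Cc μ A) : 0 ≤ norm₂ ξ := Real.sqrt_nonneg _

theorem norm₂_sq (ξ : Cc μ A) : norm₂ ξ ^ 2 = ‖inner ξ ξ‖ := Real.sq_sqrt (norm_nonneg _)

theorem norm_inner_le (ξ η : Cc μ A) : ‖inner ξ η‖ ≤ norm₂ ξ * norm₂ η := by
  rw [norm₂, norm₂, ← Real.sqrt_mul (norm_nonneg _)]
  exact Real.le_sqrt_of_sq_le (norm_inner_sq_le ξ η)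

theorem norm₂_add_le (ξ η : Cc μ A) : norm₂ (ξ + η) ≤ norm₂ ξ + norm₂ η := by
  refine abs_le_of_sq_le_sq' ?_ (add_nonneg (norm₂_nonneg _) (norm₂_nonneg _)) |>.2
  rw [norm₂_sq, inner_add_left, inner_add_right, inner_add_right]
  have h1 := norm_inner_le ξ η
  have h2 := norm_inner_le η ξ
  have h3 := norm_add_le (inner ξ ξ + inner ξ η) (inner η ξ + inner η η)
  have h4 := norm_add_le (inner ξ ξ) (inner ξ η)
  have h5 := norm_add_le (inner η ξ) (inner η η)
  rw [← norm₂_sq] at h4 h5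
  nlinarith

theorem norm₂_smul (c : ℂ) (ξ : Cc μ A) : norm₂ (c • ξ) = ‖c‖ * norm₂ ξ := by
  rw [norm₂, inner_smul_smul, norm_smul, norm_mul, norm_star, Real.sqrt_mul (by positivity),
    Real.sqrt_mul_self (norm_nonneg c), norm₂]

theorem norm₂_translate_le (a : A) (t : G) (ξ : Cc μ A) :
    norm₂ (translate a t ξ) ≤ ‖a‖ * norm₂ ξ := by
  let := CStarAlgebra.spectralOrder A
  have := CStarAlgebra.spectralOrderedRing A
  refine abs_le_of_sq_le_sq' ?_ (mul_nonneg (norm_nonneg _) (norm₂_nonneg _)) |>.2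
  rw [norm₂_sq, mul_pow, norm₂_sq]
  refine (CStarAlgebra.norm_le_norm_of_nonneg_of_le (inner_self_nonneg _)
    (inner_translate_le a t ξ)).trans_eq ?_
  rw [norm_smul, Real.norm_of_nonneg (sq_nonneg _)]

theorem norm_inner_mul_le (η f ξ : Cc μ A) :
    ‖inner η (f * ξ)‖ ≤ ‖f‖ * (norm₂ η * norm₂ ξ) := by
  rw [inner_mul_right, norm_def, ← integral_mul_const]
  refine norm_integral_le_of_norm_le (f.integrable.norm.mul_const _) (ae_of_all _ fun t => ?_)
  refine (norm_inner_le _ _).trans ?_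
  refine (mul_le_mul_of_nonneg_left (norm₂_translate_le _ _ _) (norm₂_nonneg _)).trans_eq ?_
  ring

/-- Test the weak estimate `norm_inner_mul_le` against `η = f * ξ` and cancel one factor `norm₂ (f *
ξ)`. -/
theorem norm₂_mul_le (f ξ : Cc μ A) : norm₂ (f * ξ) ≤ ‖f‖ * norm₂ ξ := by
  have h := norm_inner_mul_le (f * ξ) f ξ
  rw [← norm₂_sq] at h
  rcases (norm₂_nonneg (f * ξ)).eq_or_lt with h0 | h0
  · rw [← h0]
    exact mul_nonneg (norm_nonneg _) (norm₂_nonneg _)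
  · nlinarith

end Cc

end GroupL1

/-! ### The left regular representation and its C⋆-completion. -/

namespace GroupL1

variable {G : Type*} [Group G] [TopologicalSpace G] [IsTopologicalGroup G]
  [LocallyCompactSpace G] [T2Space G] [MeasurableSpace G] [BorelSpace G]
  (μ : Measure G) [μ.IsHaarMeasure] (A : Type*) [NonUnitalCStarAlgebra A]

/-- The space `C_c(G, A)` with the norm of the Hilbert module `L²(G, A)`. -/
def PreL2 {G : Type*} [TopologicalSpace G] [MeasurableSpace G] (μ : Measure G)
    (A : Type*) [NonUnitalCStarAlgebra A] : Type _ := Cc μ A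

instance : SeminormedAddCommGroup (PreL2 μ A) :=
  ({ toFun := Cc.norm₂
     map_zero' := by simp [Cc.norm₂, Cc.inner]
     add_le' := Cc.norm₂_add_le
     neg' := fun ξ => by rw [Cc.norm₂, Cc.inner_neg_neg, Cc.norm₂] } :
    AddGroupSeminorm (Cc μ A)).toSeminormedAddCommGroup

instance : NormedSpace ℂ (PreL2 μ A) :=
  { (inferInstanceAs (Module ℂ (Cc μ A)) : Module ℂ (Cc μ A)) with
    norm_smul_le := fun c ξ => (Cc.norm₂_smul c ξ).le }

/-- The left regular representation of `C_c(G, A)`. -/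
def leftRegular : Cc μ A →ₙₐ[ℂ] (PreL2 μ A →L[ℂ] PreL2 μ A) where
  toFun f := LinearMap.mkContinuous
    ({ toFun := fun ξ : Cc μ A => f * ξ
       map_add' := mul_add f
       map_smul' := fun c ξ => mul_smul_comm c f ξ } : Cc μ A →ₗ[ℂ] Cc μ A) ‖f‖
    (Cc.norm₂_mul_le f)
  map_smul' c f := ContinuousLinearMap.ext fun ξ => smul_mul_assoc c f (show Cc μ A from ξ)
  map_zero' := ContinuousLinearMap.ext fun ξ => zero_mul (show Cc μ A from ξ)
  map_add' f g := ContinuousLinearMap.ext fun ξ => add_mul f g (show Cc μ A from ξ)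
  map_mul' f g := ContinuousLinearMap.ext fun ξ => mul_assoc f g (show Cc μ A from ξ)

variable {μ A}

theorem norm₂_mul_le_leftRegular (f ξ : Cc μ A) :
    Cc.norm₂ (f * ξ) ≤ ‖leftRegular μ A f‖ * Cc.norm₂ ξ :=
  (leftRegular μ A f).le_opNorm ξ

/-- This is the nontrivial half of the C⋆-identity: `⟨fξ, fξ⟩ = ⟨ξ, (star f * f)ξ⟩`, followed by
Cauchy–Schwarz. -/
theorem norm_leftRegular_sq_le (f : Cc μ A) :
    ‖leftRegular μ A f‖ ^ 2 ≤ ‖leftRegular μ A (star f * f)‖ := by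
  refine (Real.le_sqrt (norm_nonneg _) (norm_nonneg _)).1 ?_
  refine ContinuousLinearMap.opNorm_le_bound _ (Real.sqrt_nonneg _) fun ξ => ?_
  change Cc.norm₂ (f * (show Cc μ A from ξ)) ≤ _ * Cc.norm₂ ξ
  generalize (show Cc μ A from ξ) = ξ
  rw [← Real.sqrt_sq (Cc.norm₂_nonneg ξ), ← Real.sqrt_mul (norm_nonneg _)]
  refine Real.le_sqrt_of_sq_le ?_
  rw [Cc.norm₂_sq, Cc.inner_mul_left, ← mul_assoc]
  refine (Cc.norm_inner_le _ _).trans ?_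
  refine (mul_le_mul_of_nonneg_left (norm₂_mul_le_leftRegular _ _)
    (Cc.norm₂_nonneg _)).trans_eq ?_
  ring

/-- Submultiplicativity gives `‖λ(f)‖² ≤ ‖λ(star f)‖ ‖λ(f)‖`, so the involution is isometric without
any adjoint operators on the module. -/
theorem norm_leftRegular_le_star (f : Cc μ A) :
    ‖leftRegular μ A f‖ ≤ ‖leftRegular μ A (star f)‖ := by
  have h1 := norm_leftRegular_sq_le f
  rw [map_mul] at h1
  have h2 := norm_mul_le (leftRegular μ A (star f)) (leftRegular μ A f)
  rcases (norm_nonneg (leftRegular μ A f)).eq_or_lt with h0 | h0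
  · rw [← h0]
    exact norm_nonneg _
  · nlinarith

/-- The algebra `C_c(G, A)` with the norm of the left regular representation. -/
def PreReduced {G : Type*} [TopologicalSpace G] [MeasurableSpace G] (μ : Measure G)
    (A : Type*) [NonUnitalCStarAlgebra A] : Type _ := Cc μ A

namespace PreReduced

instance : NonUnitalSeminormedRing (PreReduced μ A) :=
  NonUnitalSeminormedRing.induced (Cc μ A) (PreL2 μ A →L[ℂ] PreL2 μ A) (leftRegular μ A)

instance : StarRing (PreReduced μ A) := inferInstanceAs (StarRing (Cc μ A))

instance : NormedStarGroup (PreReduced μ A) where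
  norm_star_le f := by
    have := norm_leftRegular_le_star (star (show Cc μ A from f))
    rwa [star_star] at this

instance : NormedSpace ℂ (PreReduced μ A) :=
  { (inferInstanceAs (Module ℂ (Cc μ A)) : Module ℂ (Cc μ A)) with
    norm_smul_le := fun c f => by
      change ‖leftRegular μ A (c • (show Cc μ A from f))‖ ≤ ‖c‖ * ‖leftRegular μ A f‖
      rw [map_smul, norm_smul] }

instance : IsScalarTower ℂ (PreReduced μ A) (PreReduced μ A) :=
  inferInstanceAs (IsScalarTower ℂ (Cc μ A) (Cc μ A))

instance : SMulCommClass ℂ (PreReduced μ A) (PreReduced μ A) :=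
  inferInstanceAs (SMulCommClass ℂ (Cc μ A) (Cc μ A))

instance : StarModule ℂ (PreReduced μ A) := inferInstanceAs (StarModule ℂ (Cc μ A))

theorem norm_mul_self_le (f : PreReduced μ A) : ‖f‖ * ‖f‖ ≤ ‖star f * f‖ := by
  rw [← sq]
  exact norm_leftRegular_sq_le (show Cc μ A from f)

end PreReduced

variable (μ A) in
/-- The reduced crossed product of `A` by the trivial action of `G`. -/
def ReducedCStar : Type _ := UniformSpace.Completion (PreReduced μ A)

namespace ReducedCStar

instance : NormedAddCommGroup (ReducedCStar μ A) :=
  inferInstanceAs (NormedAddCommGroup (UniformSpace.Completion (PreReduced μ A)))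

instance : NormedSpace ℂ (ReducedCStar μ A) :=
  inferInstanceAs (NormedSpace ℂ (UniformSpace.Completion (PreReduced μ A)))

instance : CompleteSpace (ReducedCStar μ A) :=
  inferInstanceAs (CompleteSpace (UniformSpace.Completion (PreReduced μ A)))

/-- The canonical map to the completion. -/
def ofPre : PreReduced μ A →ₗᵢ[ℂ] ReducedCStar μ A :=
  (UniformSpace.Completion.toComplₗᵢ :
    PreReduced μ A →ₗᵢ[ℂ] UniformSpace.Completion (PreReduced μ A))

theorem denseRange_ofPre : DenseRange (ofPre : PreReduced μ A → ReducedCStar μ A) :=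
  UniformSpace.Completion.denseRange_coe (α := PreReduced μ A)

instance : NonUnitalNormedRing (ReducedCStar μ A) :=
  DenseExtension.nonUnitalNormedRing (ofPre (μ := μ) (A := A)) denseRange_ofPre

instance : StarRing (ReducedCStar μ A) :=
  DenseExtension.starRing (ofPre (μ := μ) (A := A)) denseRange_ofPre

instance : NormedStarGroup (ReducedCStar μ A) :=
  DenseExtension.normedStarGroup (ofPre (μ := μ) (A := A)) denseRange_ofPre

instance : IsScalarTower ℂ (ReducedCStar μ A) (ReducedCStar μ A) :=
  DenseExtension.isScalarTower (ofPre (μ := μ) (A := A)) denseRange_ofPre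

instance : SMulCommClass ℂ (ReducedCStar μ A) (ReducedCStar μ A) :=
  DenseExtension.smulCommClass (ofPre (μ := μ) (A := A)) denseRange_ofPre

instance : StarModule ℂ (ReducedCStar μ A) :=
  DenseExtension.starModule (ofPre (μ := μ) (A := A)) denseRange_ofPre

variable (μ A) in
/-- The canonical star-homomorphism from `C_c(G, A)`. -/
def ofCc : Cc μ A →⋆ₙₐ[ℂ] ReducedCStar μ A where
  toFun f := ofPre (show PreReduced μ A from f)
  map_smul' c f := ofPre.map_smul c (show PreReduced μ A from f)
  map_zero' := ofPre.map_zero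
  map_add' f g := ofPre.map_add (show PreReduced μ A from f) (show PreReduced μ A from g)
  map_mul' _ _ := (DenseExtension.mulL_coe_coe ofPre denseRange_ofPre _ _).symm
  map_star' _ := (DenseExtension.starL_coe ofPre denseRange_ofPre _).symm

theorem norm_ofCc (f : Cc μ A) : ‖ofCc μ A f‖ = ‖leftRegular μ A f‖ := ofPre.norm_map _

theorem denseRange_ofCc : DenseRange (ofCc μ A) := denseRange_ofPre

instance : CStarRing (ReducedCStar μ A) where
  norm_mul_self_le x := by
    induction x using denseRange_ofCc.induction_on with
    | hp => exact isClosed_le (by fun_prop) (by fun_prop)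
    | ih f =>
      rw [← map_star, ← map_mul, norm_ofCc, norm_ofCc]
      exact PreReduced.norm_mul_self_le f

instance : NonUnitalCStarAlgebra (ReducedCStar μ A) where

end ReducedCStar

/-! ### Subexponential growth -/

/-- A group of subexponential growth is unimodular: the modular function is at most `1` at every
element, and hence constant. -/
theorem modularCharacterFun_le_one [μ.Regular] (hG : HasSubexponentialGrowth μ) (x : G) :
    (Measure.modularCharacterFun x : ℝ) ≤ 1 := by
  obtain ⟨U, hU, hU1⟩ := exists_compact_mem_nhds (1 : G)
  have hmap : ∀ y : G, μ ((· * y) ⁻¹' U) = Measure.modularCharacterFun y * μ U := fun y => by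
    have h1 : μ.map (· * y) = Measure.modularCharacterFun y • μ := by
      have : (μ.map (· * y)).Regular := Measure.Regular.map (Homeomorph.mulRight y)
      rw [Measure.modularCharacterFun_eq_haarScalarFactor μ]
      exact Measure.isMulLeftInvariant_eq_smul_of_regular _ μ
    rw [← Measure.map_apply (measurable_mul_const y) hU.measurableSet, h1]
    rfl
  have hpos : 0 < μ.real U :=
    ENNReal.toReal_pos (Measure.measure_pos_of_mem_nhds μ hU1).ne' hU.measure_lt_top.ne
  have key : ∀ t : ℝ, 0 < t → (Measure.modularCharacterFun x : ℝ) ≤ Real.exp t * 1 := by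
    intro t ht
    obtain ⟨C, hC, hK⟩ := hG (U ∪ {x⁻¹}) (hU.union isCompact_singleton) t ht
    refine le_of_forall_pow_add_le_mul_pow (C := C * Real.exp t / μ.real U) 0 (by positivity)
      fun n => ?_
    -- The left side is `U x⁻ⁿ`, of measure `modularCharacterFun x ^ n * μ U`. Growth of `K = U ∪
    -- {x⁻¹}` therefore makes this at most a constant times `exp(tn)`.
    have hsub : (· * x ^ n) ⁻¹' U ⊆ (U ∪ {x⁻¹}) ^ (n + 1) := by
      intro u hu
      rw [pow_succ']
      exact ⟨u * x ^ n, Or.inl hu, x⁻¹ ^ n, Set.pow_mem_pow (Or.inr rfl), by simp⟩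
    have h1 := ENNReal.toReal_mono ENNReal.ofReal_ne_top ((measure_mono hsub).trans (hK (n + 1)))
    have h2 : Measure.modularCharacterFun (x ^ n) = Measure.modularCharacterFun x ^ n :=
      map_pow (Measure.modularCharacter (G := G)) x n
    rw [hmap, h2, ENNReal.toReal_mul, ENNReal.toReal_ofReal (by positivity)] at h1
    rw [div_mul_eq_mul_div, le_div_iff₀ hpos, mul_one, add_zero]
    refine h1.trans_eq ?_
    rw [← Real.exp_nat_mul, mul_assoc, ← Real.exp_add]
    congr 2
    push_cast
    ring
  exact le_of_forall_le_exp_mul key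

theorem isCompact_pow {K : Set G} (hK : IsCompact K) (n : ℕ) : IsCompact (K ^ n) := by
  induction n with
  | zero => exact (pow_zero K).symm ▸ isCompact_singleton
  | succ n ih => exact (pow_succ K n).symm ▸ ih.mul hK

namespace Cc

theorem norm₂_translateRight_le {g : G} (hg : (Measure.modularCharacterFun g : ℝ) ≤ 1)
    (ξ : Cc μ A) : norm₂ (translateRight g ξ) ≤ norm₂ ξ := by
  rw [norm₂, norm₂, inner_translateRight, norm_smul, NNReal.norm_eq]
  exact Real.sqrt_le_sqrt (mul_le_of_le_one_left (norm_nonneg _) hg)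

theorem mem_pow_of_iterate_mul_ne_zero (b : Cc μ A) (n : ℕ) {x : G}
    (hx : ((b * ·)^[n] b) x ≠ 0) : x ∈ tsupport b ^ (n + 1) := by
  induction n generalizing x with
  | zero => simpa using subset_tsupport _ hx
  | succ n ih =>
    rw [Function.iterate_succ_apply', mul_apply] at hx
    obtain ⟨t, ht⟩ : ∃ t, b t * ((b * ·)^[n] b) (t⁻¹ * x) ≠ 0 := by
      by_contra! h
      simp [h] at hx
    rw [pow_succ']
    exact ⟨t, subset_tsupport _ (left_ne_zero_of_mul ht), t⁻¹ * x,
      ih (right_ne_zero_of_mul ht), by simp⟩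

theorem norm₂_iterate_mul_le (b : Cc μ A) (n : ℕ) :
    norm₂ ((b * ·)^[n] b) ≤ ‖leftRegular μ A b‖ ^ n * norm₂ b := by
  induction n with
  | zero => simp
  | succ n ih =>
    rw [Function.iterate_succ_apply', pow_succ', mul_assoc]
    exact (norm₂_mul_le_leftRegular _ _).trans (mul_le_mul_of_nonneg_left ih (norm_nonneg _))

theorem norm_le_of_support_subset (f : Cc μ A) {S : Set G} (hS : IsCompact S) {M : ℝ}
    (hf : ∀ x, f x ≠ 0 → x ∈ S) (hM : ∀ x, ‖f x‖ ≤ M) : ‖f‖ ≤ M * μ.real S := by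
  rw [norm_def, ← setIntegral_eq_integral_of_forall_compl_eq_zero (s := S) fun x hx => ?_]
  · refine (Real.le_norm_self _).trans
      (norm_setIntegral_le_of_norm_le_const hS.measure_lt_top fun x _ => ?_)
    simpa using hM x
  · by_contra hne
    exact hx (hf x (norm_ne_zero_iff.1 hne))

/-- The `L¹` norm is at most the supremum times the measure of the support. In `b^(n+2)` the first
factor is tested through `star b`, the last is the starting vector, and the remaining `n` each
contribute `‖λ(b)‖`. -/
theorem exists_norm_iterate_mul_le [μ.Regular] (hG : HasSubexponentialGrowth μ) (b : Cc μ A)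
    (t : ℝ) (ht : 0 < t) :
    ∃ C : ℝ, ∀ n : ℕ, ‖(b * ·)^[n + 1] b‖ ≤ C * (Real.exp t * ‖leftRegular μ A b‖) ^ n := by
  obtain ⟨C, hC, hK⟩ := hG (tsupport b) b.hasCompactSupport t ht
  -- The factor `exp(2t)` accounts for the support lying in a power `n + 2` of `tsupport b`.
  refine ⟨norm₂ (star b) * norm₂ b * (C * Real.exp (t * 2)), fun n => ?_⟩
  have hle : ∀ x, ‖((b * ·)^[n + 1] b) x‖ ≤
      norm₂ (star b) * (‖leftRegular μ A b‖ ^ n * norm₂ b) := fun x => by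
    rw [Function.iterate_succ_apply', mul_apply_eq_inner]
    refine (norm_inner_le _ _).trans (mul_le_mul_of_nonneg_left ?_ (norm₂_nonneg _))
    exact (norm₂_translateRight_le (modularCharacterFun_le_one hG x) _).trans
      (norm₂_iterate_mul_le b n)
  have hS : IsCompact (tsupport b ^ (n + 1 + 1)) := isCompact_pow b.hasCompactSupport _
  have hμ := ENNReal.toReal_mono ENNReal.ofReal_ne_top (hK (n + 1 + 1))
  rw [ENNReal.toReal_ofReal (by positivity)] at hμ
  refine (norm_le_of_support_subset _ hS (fun x hx => mem_pow_of_iterate_mul_ne_zero b _ hx)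
    hle).trans ?_
  have h0 := norm₂_nonneg (star b)
  have h1 := norm₂_nonneg b
  refine (mul_le_mul_of_nonneg_left hμ (by positivity)).trans_eq ?_
  have : Real.exp (t * ((n + 1 + 1 : ℕ) : ℝ)) = Real.exp (t * 2) * Real.exp t ^ n := by
    rw [← Real.exp_nat_mul, ← Real.exp_add]
    congr 1
    push_cast
    ring
  rw [this, mul_pow]
  ring

variable (μ A) in
/-- The inclusion of `C_c(G, A)` into `L¹(G, A)`, as a homomorphism of algebras. -/
def toL1AlgHom [μ.Regular] : Cc μ A →ₙₐ[ℂ] L1 μ A where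
  toFun := toL1
  map_smul' := map_smul toL1
  map_zero' := map_zero toL1
  map_add' := map_add toL1
  map_mul' := toL1_mul

end Cc

theorem isQuasiSymmetric_ccSubalgebra [μ.Regular] (hG : HasSubexponentialGrowth μ) :
    IsQuasiSymmetric (ccSubalgebra μ A) := by
  rintro _ ⟨f, rfl⟩
  rw [← toL1_star, ← toL1_mul]
  refine quasispectrum_star_mul_self_subset (Cc.toL1AlgHom μ A) (ReducedCStar.ofCc μ A)
    (fun b t ht => ?_) f
  obtain ⟨C, hC⟩ := Cc.exists_norm_iterate_mul_le hG b t ht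
  refine ⟨C, fun n => ?_⟩
  rw [ReducedCStar.norm_ofCc]
  exact (Cc.toL1.norm_map _).trans_le (hC n)

end GroupL1

/-! ### The projective tensor product `L¹(G) ⊗_γ A` -/

namespace ProjTensor

variable {X Y : Type*}
  [NonUnitalNormedRing X] [StarRing X] [NormedStarGroup X] [NormedSpace ℂ X]
  [IsScalarTower ℂ X X] [SMulCommClass ℂ X X] [StarModule ℂ X]
  [NonUnitalNormedRing Y] [StarRing Y] [NormedStarGroup Y] [NormedSpace ℂ Y]
  [IsScalarTower ℂ Y Y] [SMulCommClass ℂ Y Y] [StarModule ℂ Y]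

theorem norm_tmul_le (x : X) (y : Y) : ‖(tmul x y : ProjTensor X Y)‖ ≤ ‖x‖ * ‖y‖ :=
  (ofAlg.norm_map _).trans_le (projNorm_tmul_le x y)

variable (X Y) in
/-- The elementary tensor, as a continuous bilinear map. -/
def tmulL : X →L[ℂ] Y →L[ℂ] ProjTensor X Y :=
  LinearMap.mkContinuous₂ (LinearMap.mk₂ ℂ tmul
    (fun x x' y => (congrArg ofAlg (TensorProduct.add_tmul x x' y)).trans (map_add ofAlg _ _))
    (fun c x y => (ofAlg.map_smul c (show Alg X Y from x ⊗ₜ[ℂ] y)))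
    (fun x y y' => (congrArg ofAlg (TensorProduct.tmul_add x y y')).trans (map_add ofAlg _ _))
    (fun c x y => (congrArg ofAlg (TensorProduct.tmul_smul c x y)).trans (map_smul ofAlg _ _))) 1
    fun x y => (norm_tmul_le x y).trans_eq (by rw [one_mul])

theorem tmulL_apply (x : X) (y : Y) : tmulL X Y x y = tmul x y := rfl

/-- A closed additive property of elements of the projective tensor product holds if it holds for
elementary tensors. -/
theorem induction {p : ProjTensor X Y → Prop} (hc : IsClosed {z | p z}) (h0 : p 0)
    (hadd : ∀ z w, p z → p w → p (z + w)) (ht : ∀ x y, p (tmul x y)) (z : ProjTensor X Y) : p z := by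
  refine denseRange_ofAlg.induction_on z hc fun w => ?_
  refine TensorProduct.induction_on (motive := fun w : X ⊗[ℂ] Y => p (ofAlg (show Alg X Y from w)))
    w ?_ ht fun z w hz hw => ?_
  · exact (map_zero (ofAlg (X := X) (Y := Y))).symm ▸ h0
  · exact (map_add (ofAlg (X := X) (Y := Y)) z w).symm ▸ hadd _ _ hz hw

variable {Z : Type*} [NormedAddCommGroup Z] [NormedSpace ℂ Z] [CompleteSpace Z]

/-- The linear map on the algebraic tensor product induced by a bilinear map. -/
def liftAlg (B : X →ₗ[ℂ] Y →ₗ[ℂ] Z) : Alg X Y →ₗ[ℂ] Z := TensorProduct.lift B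

/-- The triangle inequality holds for each representation of `z` as a sum of elementary tensors; the
projective norm is the infimum over these. -/
theorem norm_liftAlg_le (B : X →ₗ[ℂ] Y →ₗ[ℂ] Z) (hB : ∀ x y, ‖B x y‖ ≤ ‖x‖ * ‖y‖) (z : Alg X Y) :
    ‖liftAlg B z‖ ≤ 1 * ‖(ofAlg : Alg X Y →ₗᵢ[ℂ] ProjTensor X Y).toLinearMap z‖ := by
  rw [one_mul, LinearIsometry.coe_toLinearMap, LinearIsometry.norm_map]
  refine le_projNorm (z := z) fun l hl => ?_
  rw [← hl]
  clear hl
  induction l with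
  | nil =>
    simp only [List.map_nil, List.sum_nil]
    exact ((congrArg norm (map_zero (TensorProduct.lift B))).trans norm_zero).le
  | cons p l ih =>
    simp only [List.map_cons, List.sum_cons]
    refine (congrArg norm (map_add (TensorProduct.lift B) _ _)).trans_le ?_
    exact (norm_add_le _ _).trans (add_le_add (hB p.1 p.2) ih)

/-- The contraction on the projective tensor product induced by a contractive bilinear map. -/
def lift (B : X →ₗ[ℂ] Y →ₗ[ℂ] Z) : ProjTensor X Y →L[ℂ] Z :=
  (liftAlg B).extendOfNorm ofAlg.toLinearMap

theorem lift_tmul (B : X →ₗ[ℂ] Y →ₗ[ℂ] Z) (hB : ∀ x y, ‖B x y‖ ≤ ‖x‖ * ‖y‖) (x : X) (y : Y) :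
    lift B (tmul x y) = B x y :=
  LinearMap.extendOfNorm_eq (e := ofAlg.toLinearMap) denseRange_ofAlg ⟨_, norm_liftAlg_le B hB⟩ _

theorem norm_lift_le (B : X →ₗ[ℂ] Y →ₗ[ℂ] Z) (hB : ∀ x y, ‖B x y‖ ≤ ‖x‖ * ‖y‖)
    (z : ProjTensor X Y) : ‖lift B z‖ ≤ ‖z‖ := by
  exact (LinearMap.norm_extendOfNorm_apply_le (e := ofAlg.toLinearMap) denseRange_ofAlg 1
    (norm_liftAlg_le B hB) z).trans_eq (one_mul _)

end ProjTensor

/-! ### Elementary tensors and indicator functions in `L¹(G, A)`. -/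

namespace GroupL1

section Lp

variable {G : Type*} [MeasurableSpace G] {μ : Measure G} {A : Type*} [NonUnitalCStarAlgebra A]

theorem norm_smulConst_le (f : L1 μ ℂ) (a : A) : ‖smulConst f a‖ ≤ ‖f‖ * ‖a‖ := by
  refine ((ContinuousLinearMap.toSpanSingleton ℂ a).norm_compLp_le (show Lp ℂ 1 μ from f)).trans_eq
    ?_
  rw [ContinuousLinearMap.norm_toSpanSingleton, mul_comm]
  rfl

variable (μ A) in
/-- `smulConst`, as a bilinear map. -/
def smulConstₗ : L1 μ ℂ →ₗ[ℂ] A →ₗ[ℂ] L1 μ A :=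
  LinearMap.mk₂ ℂ smulConst
    (fun f g a => map_add ((ContinuousLinearMap.toSpanSingleton ℂ a).compLpₗ 1 μ)
      (show Lp ℂ 1 μ from f) (show Lp ℂ 1 μ from g))
    (fun c f a => map_smul ((ContinuousLinearMap.toSpanSingleton ℂ a).compLpₗ 1 μ) c
      (show Lp ℂ 1 μ from f))
    (fun f a b => by
      rw [smulConst, ContinuousLinearMap.toSpanSingleton_add]
      exact ContinuousLinearMap.add_compLp _ _ _)
    (fun c f a => by
      rw [smulConst, ContinuousLinearMap.toSpanSingleton_smul]
      exact ContinuousLinearMap.smul_compLp _ _ _)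

variable (μ A) in
/-- `smulConst`, as a continuous bilinear map. -/
def smulConstL : L1 μ ℂ →L[ℂ] A →L[ℂ] L1 μ A :=
  LinearMap.mkContinuous₂ (smulConstₗ μ A) 1 fun f a =>
    (norm_smulConst_le f a).trans_eq (by rw [one_mul])

theorem smulConstL_apply (f : L1 μ ℂ) (a : A) : smulConstL μ A f a = smulConst f a := rfl

/-- The class in `L¹(G, A)` of the function with value `a` on `s` and `0` elsewhere. -/
def indicatorConst {s : Set G} (hs : MeasurableSet s) (hμs : μ s ≠ ⊤) (a : A) : L1 μ A :=
  indicatorConstLp 1 hs hμs a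

theorem smulConst_indicatorConst {s : Set G} (hs : MeasurableSet s) (hμs : μ s ≠ ⊤) (c : ℂ)
    (a : A) : smulConst (indicatorConst hs hμs c) a = indicatorConst hs hμs (c • a) := by
  refine Lp.ext (μ := μ) (p := 1) (E := A) ?_
  filter_upwards [(ContinuousLinearMap.toSpanSingleton ℂ a).coeFn_compLp
    (indicatorConstLp 1 hs hμs c), indicatorConstLp_coeFn (p := 1) (hs := hs) (hμs := hμs) (c := c),
    indicatorConstLp_coeFn (p := 1) (hs := hs) (hμs := hμs) (c := c • a)] with x h1 h2 h3
  refine h1.trans (Eq.trans ?_ h3.symm)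
  rw [h2]
  by_cases hx : x ∈ s <;> simp [hx]

theorem norm_indicatorConst {s : Set G} (hs : MeasurableSet s) (hμs : μ s ≠ ⊤) (a : A) :
    ‖(indicatorConst hs hμs a : L1 μ A)‖ = ‖a‖ * μ.real s :=
  (norm_indicatorConstLp one_ne_zero ENNReal.one_ne_top).trans (by simp)

theorem L1.induction_indicatorConst {p : L1 μ A → Prop} (hc : IsClosed {f | p f})
    (hadd : ∀ f g, p f → p g → p (f + g))
    (hi : ∀ (a : A) {s : Set G} (hs : MeasurableSet s) (hμs : μ s ≠ ⊤), p (indicatorConst hs hμs a))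
    (f : L1 μ A) : p f := by
  refine Lp.induction ENNReal.one_ne_top p (fun c s hs hμs => ?_) (fun f g hf hg _ hpf hpg => ?_)
    hc f
  · rw [Lp.simpleFunc.coe_indicatorConst]
    exact hi c hs hμs.ne
  · exact hadd _ _ hpf hpg

end Lp

end GroupL1

/-! ### The two mutually inverse contractions. -/

namespace GroupL1

variable {G : Type*} [Group G] [TopologicalSpace G] [IsTopologicalGroup G]
  [LocallyCompactSpace G] [T2Space G] [MeasurableSpace G] [BorelSpace G]
  {μ : Measure G} [μ.IsHaarMeasure] [μ.Regular] {A : Type*} [NonUnitalCStarAlgebra A]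

variable (μ A) in
/-- The canonical contraction from the projective tensor product to `L¹(G, A)`. -/
def ofTensor : ProjTensor (L1 μ ℂ) A →L[ℂ] L1 μ A := ProjTensor.lift (smulConstₗ μ A)

theorem ofTensor_tmul (f : L1 μ ℂ) (a : A) :
    ofTensor μ A (ProjTensor.tmul f a) = smulConst f a :=
  ProjTensor.lift_tmul _ norm_smulConst_le f a

theorem norm_ofTensor_le (z : ProjTensor (L1 μ ℂ) A) : ‖ofTensor μ A z‖ ≤ ‖z‖ :=
  ProjTensor.norm_lift_le _ norm_smulConst_le z

open scoped Classical in
variable (μ A) in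
/-- The vector measure `s ↦ (a ↦ 1_s ⊗ a)`. -/
def tensorMeasure (s : Set G) : A →L[ℝ] ProjTensor (L1 μ ℂ) A :=
  -- The default value `0` is harmless: additivity and domination concern only measurable sets of
  -- finite measure.
  if h : MeasurableSet s ∧ μ s ≠ ⊤ then
    (ProjTensor.tmulL (L1 μ ℂ) A (indicatorConst h.1 h.2 1)).restrictScalars ℝ
  else 0

theorem tensorMeasure_apply {s : Set G} (hs : MeasurableSet s) (hμs : μ s ≠ ⊤) (a : A) :
    tensorMeasure μ A s a = ProjTensor.tmul (indicatorConst hs hμs 1) a := by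
  rw [tensorMeasure, dif_pos ⟨hs, hμs⟩]
  rfl

/-- Additivity comes from that of indicators. The constant `1`, from `‖1_s ⊗ a‖ ≤ μ(s) ‖a‖`, is what
makes the extension to `L¹(G, A)` a contraction. -/
theorem dominatedFinMeasAdditive_tensorMeasure :
    DominatedFinMeasAdditive μ (tensorMeasure μ A) 1 := by
  refine ⟨fun s t hs ht hμs hμt hst => ?_, fun s hs hμs => ?_⟩
  · ext a
    have hu : μ (s ∪ t) ≠ ⊤ := measure_union_ne_top hμs hμt
    have h : (indicatorConst (hs.union ht) hu 1 : L1 μ ℂ) =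
        indicatorConst hs hμs 1 + indicatorConst ht hμt 1 :=
      indicatorConstLp_disjoint_union hs ht hμs hμt hst 1
    rw [add_apply, tensorMeasure_apply hs hμs, tensorMeasure_apply ht hμt,
      tensorMeasure_apply (hs.union ht) hu, h]
    simp only [← ProjTensor.tmulL_apply, map_add, add_apply]
  · refine ContinuousLinearMap.opNorm_le_bound _ (by positivity) fun a => ?_
    rw [tensorMeasure_apply hs hμs.ne]
    refine (ProjTensor.norm_tmul_le _ _).trans_eq ?_
    rw [norm_indicatorConst, norm_one]

variable (μ A) in
/-- The canonical contraction from `L¹(G, A)` to the projective tensor product. -/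
def toTensor : L1 μ A →L[ℝ] ProjTensor (L1 μ ℂ) A :=
  MeasureTheory.L1.setToL1 (E := A) (μ := μ) dominatedFinMeasAdditive_tensorMeasure

theorem norm_toTensor_le (f : L1 μ A) : ‖toTensor μ A f‖ ≤ ‖f‖ :=
  (L1.norm_setToL1_le_mul_norm (E := A) (μ := μ) dominatedFinMeasAdditive_tensorMeasure zero_le_one
    f).trans_eq (one_mul _)

theorem toTensor_indicatorConst {s : Set G} (hs : MeasurableSet s) (hμs : μ s ≠ ⊤) (a : A) :
    toTensor μ A (indicatorConst hs hμs a) = ProjTensor.tmul (indicatorConst hs hμs 1) a :=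
  (L1.setToL1_indicatorConstLp (E := A) (μ := μ) dominatedFinMeasAdditive_tensorMeasure hs hμs
    a).trans (tensorMeasure_apply hs hμs a)

theorem ofTensor_toTensor (f : L1 μ A) : ofTensor μ A (toTensor μ A f) = f := by
  induction f using L1.induction_indicatorConst with
  | hc => exact isClosed_eq (by fun_prop) (by fun_prop)
  | hadd f g hf hg => rw [map_add, map_add, hf, hg]
  | hi a hs hμs =>
    rw [toTensor_indicatorConst, ofTensor_tmul, smulConst_indicatorConst, one_smul]

theorem toTensor_smulConst (f : L1 μ ℂ) (a : A) :
    toTensor μ A (smulConst f a) = ProjTensor.tmul f a := by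
  rw [← smulConstL_apply, ← ProjTensor.tmulL_apply]
  induction f using L1.induction_indicatorConst with
  | hc => exact isClosed_eq (by fun_prop) (by fun_prop)
  | hadd f g hf hg => simp only [map_add, add_apply, hf, hg]
  | hi c hs hμs =>
    -- Homogeneity of the scalar indicator is read off from linearity of `smulConst` in its second
    -- argument, with `A = ℂ`.
    have h : (indicatorConst hs hμs c : L1 μ ℂ) = c • indicatorConst hs hμs 1 := by
      have h1 := smulConst_indicatorConst (μ := μ) hs hμs (1 : ℂ) (1 : ℂ)
      have h2 := smulConst_indicatorConst (μ := μ) hs hμs (1 : ℂ) (c • (1 : ℂ))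
      rw [← smulConstL_apply] at h1 h2
      rw [map_smul, h1] at h2
      simpa using h2.symm
    rw [smulConstL_apply, smulConst_indicatorConst, toTensor_indicatorConst, h,
      ← ProjTensor.tmulL_apply]
    simp

theorem toTensor_ofTensor (z : ProjTensor (L1 μ ℂ) A) : toTensor μ A (ofTensor μ A z) = z := by
  induction z using ProjTensor.induction with
  | hc => exact isClosed_eq (by fun_prop) (by fun_prop)
  | h0 => simp
  | hadd z w hz hw => rw [map_add, map_add, hz, hw]
  | ht f a => rw [ofTensor_tmul, toTensor_smulConst]

/-- A contraction with a contractive left inverse preserves norms. -/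
theorem norm_ofTensor (z : ProjTensor (L1 μ ℂ) A) : ‖ofTensor μ A z‖ = ‖z‖ := by
  refine le_antisymm (norm_ofTensor_le z) ?_
  simpa only [toTensor_ofTensor] using norm_toTensor_le (ofTensor μ A z)

/-! ### Compatibility with product and involution. -/

namespace Cc

/-- The function `x ↦ f(x) a`. -/
def smulConst (f : Cc μ ℂ) (a : A) : Cc μ A :=
  ⟨⟨fun x => f x • a, f.continuous.smul continuous_const⟩, f.hasCompactSupport.smul_right⟩

theorem smulConst_apply (f : Cc μ ℂ) (a : A) (x : G) : smulConst f a x = f x • a := rfl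

theorem toL1_smulConst (f : Cc μ ℂ) (a : A) :
    toL1 (smulConst f a) = GroupL1.smulConst (toL1 f) a := by
  refine Lp.ext (μ := μ) (p := 1) (E := A) ?_
  filter_upwards [(ContinuousLinearMap.toSpanSingleton ℂ a).coeFn_compLp (f.memLp.toLp f),
    f.memLp.coeFn_toLp, (smulConst f a).memLp.coeFn_toLp] with x h1 h2 h3
  refine h3.trans (Eq.trans ?_ h1.symm)
  rw [h2]
  rfl

theorem smulConst_mul_smulConst (f g : Cc μ ℂ) (a b : A) :
    smulConst f a * smulConst g b = smulConst (f * g) (a * b) := by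
  ext x
  rw [smulConst_apply, mul_apply, mul_apply, ← integral_smul_const]
  simp only [smulConst_apply, smul_mul_smul_comm]

theorem star_smulConst (f : Cc μ ℂ) (a : A) :
    star (smulConst f a) = smulConst (star f) (star a) := by
  ext x
  simp only [star_apply, smulConst_apply, star_smul, smul_assoc]

end Cc

/-- The product of `L¹` is defined by extension from `C_c`, where the identity is pointwise; both
sides are continuous in `f` and in `g`. -/
theorem smulConst_mul_smulConst (f g : L1 μ ℂ) (a b : A) :
    smulConst f a * smulConst g b = smulConst (f * g) (a * b) := by
  simp only [← smulConstL_apply]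
  induction f using (Cc.denseRange_toL1 (μ := μ) (A := ℂ)).induction_on with
  | hp => exact isClosed_eq (by fun_prop) (by fun_prop)
  | ih f =>
    induction g using (Cc.denseRange_toL1 (μ := μ) (A := ℂ)).induction_on with
    | hp => exact isClosed_eq (by fun_prop) (by fun_prop)
    | ih g =>
      simp only [smulConstL_apply, ← toL1_mul, ← Cc.toL1_smulConst, Cc.smulConst_mul_smulConst]

theorem star_smulConst (f : L1 μ ℂ) (a : A) :
    star (smulConst f a) = smulConst (star f) (star a) := by
  simp only [← smulConstL_apply]
  induction f using (Cc.denseRange_toL1 (μ := μ) (A := ℂ)).induction_on with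
  | hp => exact isClosed_eq (by fun_prop) (by fun_prop)
  | ih f => simp only [smulConstL_apply, ← toL1_star, ← Cc.toL1_smulConst, Cc.star_smulConst]

theorem ofTensor_mul (z w : ProjTensor (L1 μ ℂ) A) :
    ofTensor μ A (z * w) = ofTensor μ A z * ofTensor μ A w := by
  induction z using ProjTensor.induction with
  | hc => exact isClosed_eq (by fun_prop) (by fun_prop)
  | h0 => simp
  | hadd z z' hz hz' => simp only [add_mul, map_add, hz, hz']
  | ht f a =>
    induction w using ProjTensor.induction with
    | hc => exact isClosed_eq (by fun_prop) (by fun_prop)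
    | h0 => simp
    | hadd w w' hw hw' => simp only [mul_add, map_add, hw, hw']
    | ht g b =>
      rw [ProjTensor.tmul_mul_tmul, ofTensor_tmul, ofTensor_tmul, ofTensor_tmul,
        smulConst_mul_smulConst]

theorem ofTensor_star (z : ProjTensor (L1 μ ℂ) A) :
    ofTensor μ A (star z) = star (ofTensor μ A z) := by
  induction z using ProjTensor.induction with
  | hc => exact isClosed_eq (by fun_prop) (by fun_prop)
  | h0 => simp
  | hadd z z' hz hz' => simp only [star_add, map_add, hz, hz']
  | ht f a => rw [ProjTensor.star_tmul, ofTensor_tmul, ofTensor_tmul, star_smulConst]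

variable (μ A) in
/-- The canonical isomorphism from `L¹(G) ⊗_γ A` to `L¹(G, A)`. -/
def tensorEquiv : ProjTensor (L1 μ ℂ) A ≃⋆ₐ[ℂ] L1 μ A where
  toFun := ofTensor μ A
  -- `toTensor` is built as a real-linear map only; complex linearity of the equivalence comes from
  -- `ofTensor`.
  invFun := toTensor μ A
  left_inv := toTensor_ofTensor
  right_inv := ofTensor_toTensor
  map_mul' := ofTensor_mul
  map_add' := map_add (ofTensor μ A)
  map_star' := ofTensor_star
  map_smul' := map_smul (ofTensor μ A)

end GroupL1

end

theorem mainTheorem9 {G : Type*} [Group G] [TopologicalSpace G] [IsTopologicalGroup G]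
    [LocallyCompactSpace G] [T2Space G] [MeasurableSpace G] [BorelSpace G]
    (μ : Measure G) [μ.IsHaarMeasure] [μ.Regular] (hG : HasSubexponentialGrowth μ)
    (A : Type*) [NonUnitalCStarAlgebra A] :
    IsQuasiSymmetric (GroupL1.ccSubalgebra μ A) ∧
      ∃ Φ : ProjTensor (GroupL1.L1 μ ℂ) A ≃⋆ₐ[ℂ] GroupL1.L1 μ A,
        Isometry Φ ∧
          ∀ (f : GroupL1.L1 μ ℂ) (a : A), Φ (ProjTensor.tmul f a) = GroupL1.smulConst f a :=
  ⟨GroupL1.isQuasiSymmetric_ccSubalgebra hG, GroupL1.tensorEquiv μ A,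
    AddMonoidHomClass.isometry_of_norm (GroupL1.tensorEquiv μ A) GroupL1.norm_ofTensor,
    GroupL1.ofTensor_tmul⟩
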